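/- For probability measures $P,Q$ on a common measurable space, the trade-off function $T(P,Q):[0,1]\to[0,1]$ is $$T(P,Q)(\alpha)=\inf\{\,1-\mathbb E_Q[\phi]\;:\;\phi \text{ measurable},\ 0\le\phi\le 1,\ \mathbb E_P[\phi]\le\alpha\,\}.$$ A trade-off function is a function $f:[0,1]\to[0,1]$ of the form $f=T(P,Q)$; it is symmetric if $f=f^{-1}$, where $f^{-1}(\beta)=\inf\{\alpha\in[0,1]: f(\alpha)\le\beta\}$. If $f_i=T(P_i,Q_i)$ for $1\le i\le k$, then $$f_1\otimes\cdots\otimes f_k=T(P_1\times\cdots\times P_k,\;Q_1\times\cdots\times Q_k),$$ and $G_\mu=T(\mathcal N(0,1),\mathcal N(\mu,1))$ for $\mu\in\mathbb R$. For a trade-off function $f$ (which is convex, hence differentiable almost everywhere) put $$\nu_1(f)=-\int_0^1\log|f'(x)|\,dx,\qquad \nu_2(f)=\int_0^1\bigl(\log|f'(x)|\bigr)^2dx,\qquad \nu_3(f)=\int_0^1\bigl|\log|f'(x)|\bigr|^3dx,$$ with $\log 0=-\infty$; these take values in $[0,+\infty]$. **Theorem (asymptotic normality).** Let $\{f_{ki}:1\le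 i\le k\}_{k=1}^\infty$ be a triangular array of symmetric trade-off functions, and let $M\ge 0$ and $s>0$ be real numbers such that, as $k\to\infty$, $$\sum_{i=1}^k\nu_1(f_{ki})\to M,\qquad \max_{1\le i\le k}\nu_1(f_{ki})\to 0,\qquad \sum_{i=1}^k\nu_2(f_{ki})\to s^2,\qquad \sum_{i=1}^k\nu_3(f_{ki})\to 0.$$ Then $$\lim_{k\to\infty} f_{k1}\otimes\cdots\otimes f_{kk}(\alpha)=G_{2M/s}(\alpha)\qquad\text{uniformly in }\alpha\in[0,1],$$ whichever distributions $P_{ki},Q_{ki}$ with $f_{ki}=T(P_{ki},Q_{ki})$ are used to form the compositions. -/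

import Mathlib

open MeasureTheory ProbabilityTheory Set Filter Topology
open scoped ENNReal

universe u

/-- The trade-off function `T(P, Q)`: the infimum of the type-II errors `1 - E_Q[φ]` over all
rejection rules `φ` with values in `[0, 1]` whose type-I error `E_P[φ]` is at most `α`.
It is meant for `α ∈ [0, 1]`. -/
noncomputable def tradeoff {Ω : Type u} [MeasurableSpace Ω] (P Q : Measure Ω) (α : ℝ) : ℝ :=
  sInf {β : ℝ | ∃ φ : Ω → ℝ, Measurable φ ∧ (∀ ω, φ ω ∈ Icc (0 : ℝ) 1) ∧
    ∫ ω, φ ω ∂P ≤ α ∧ β = 1 - ∫ ω, φ ω ∂Q}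

/-- `f` is, on `[0, 1]`, the trade-off function of two probability distributions on a common
measurable space. -/
def IsTradeoff (f : ℝ → ℝ) : Prop :=
  ∃ (Ω : Type u) (_ : MeasurableSpace Ω) (P Q : Measure Ω),
    IsProbabilityMeasure P ∧ IsProbabilityMeasure Q ∧ EqOn f (tradeoff P Q) (Icc 0 1)

/-- The left-continuous inverse `f⁻¹(β) = inf {α ∈ [0, 1] | f(α) ≤ β}` of a decreasing
function on `[0, 1]`. -/
noncomputable def tradeoffInv (f : ℝ → ℝ) (β : ℝ) : ℝ :=
  sInf {α : ℝ | α ∈ Icc (0 : ℝ) 1 ∧ f α ≤ β}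

/-- A symmetric trade-off function: `f = f⁻¹` on `[0, 1]`. -/
def IsSymmetricTradeoff (f : ℝ → ℝ) : Prop :=
  IsTradeoff.{u} f ∧ EqOn f (tradeoffInv f) (Icc 0 1)

/-- `h` is a composition `f₁ ⊗ ⋯ ⊗ fₖ`: on `[0, 1]` it is `T(P₁ × ⋯ × Pₖ, Q₁ × ⋯ × Qₖ)`
for some probability distributions with `fᵢ = T(Pᵢ, Qᵢ)`. -/
def IsComposition {k : ℕ} (f : Fin k → ℝ → ℝ) (h : ℝ → ℝ) : Prop :=
  ∃ (Ω : Fin k → Type u) (_ : ∀ i, MeasurableSpace (Ω i)) (P Q : ∀ i, Measure (Ω i)),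
    (∀ i, IsProbabilityMeasure (P i)) ∧ (∀ i, IsProbabilityMeasure (Q i)) ∧
    (∀ i, EqOn (f i) (tradeoff (P i) (Q i)) (Icc 0 1)) ∧
    EqOn h (tradeoff (Measure.pi P) (Measure.pi Q)) (Icc 0 1)

/-- Every finite family of trade-off functions has a composition. -/
theorem exists_isComposition {k : ℕ} (f : Fin k → ℝ → ℝ) (hf : ∀ i, IsTradeoff.{u} (f i)) :
    ∃ h : ℝ → ℝ, IsComposition.{u} f h := by
  choose Ω m P Q hP hQ hPQ using hf
  exact ⟨tradeoff (Measure.pi P) (Measure.pi Q), Ω, m, P, Q, hP, hQ, hPQ, fun _ _ => rfl⟩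

/-- `G_μ = T(N(0, 1), N(μ, 1))`. -/
noncomputable def gaussianTradeoff (μ : ℝ) : ℝ → ℝ :=
  tradeoff (gaussianReal 0 1) (gaussianReal μ 1)

/-- `log |f'(x)|` as an extended real number; it is `-∞` where `f'(x) = 0`. -/
noncomputable def logAbsDeriv (f : ℝ → ℝ) (x : ℝ) : EReal :=
  ENNReal.log (ENNReal.ofReal |deriv f x|)

/-- `ν₁(f) = - ∫₀¹ log |f'(x)| dx`, as an extended real number: the integral of the negative
part of the logarithm minus the integral of its positive part. For a trade-off function the
latter integral is finite, because `log |f'| ≤ |f'|`. -/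
noncomputable def nu1 (f : ℝ → ℝ) : EReal :=
  ((∫⁻ x in Ioo (0 : ℝ) 1, (-logAbsDeriv f x).toENNReal : ℝ≥0∞) : EReal) -
    ((∫⁻ x in Ioo (0 : ℝ) 1, (logAbsDeriv f x).toENNReal : ℝ≥0∞) : EReal)

/-- `ν₂(f) = ∫₀¹ (log |f'(x)|)² dx ∈ [0, ∞]`. -/
noncomputable def nu2 (f : ℝ → ℝ) : ℝ≥0∞ :=
  ∫⁻ x in Ioo (0 : ℝ) 1, (logAbsDeriv f x).abs ^ 2

/-- `ν₃(f) = ∫₀¹ |log |f'(x)||³ dx ∈ [0, ∞]`. -/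
noncomputable def nu3 (f : ℝ → ℝ) : ℝ≥0∞ :=
  ∫⁻ x in Ioo (0 : ℝ) 1, (logAbsDeriv f x).abs ^ 3

/-! ### Elementary properties of trade-off functions. -/

section Tradeoff

variable {Ω : Type*} [MeasurableSpace Ω] {P Q : Measure Ω}

/-! By Neyman-Pearson, testing `P` against `Q` is governed by the laws of the log-likelihood ratio
under `P` and under `Q`, and for product measures this ratio is a sum of independent terms. So the
theorem is a central limit theorem, provided the laws of the summands can be read off from the
trade-off functions alone.

They can: the slope of `f` at the level of the test `ℓ > c` is controlled by `-exp c`, so under `P`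
the ratio is distributed as `log |f'(U)|` with `U` uniform (`IsLogLikelihood.map_eq`), and the
functionals `ν` are its moments up to sign. Symmetry makes the law under `Q` the reflection of this
law (`map_llr_right_of_symmetric`). Finiteness of `ν₃`, which holds for all large `k`, rules out `f'
= 0` on a set of positive measure and, with symmetry, makes `P` and `Q` mutually absolutely
continuous.

Lyapunov's theorem (`tendsto_prod_charFun`) then gives the limits `N(-M, s²)` under the null and
`N(M, s²)` under the alternative. Half-line tests between these have the errors of `G_{2M/s}`. The
Neyman-Pearson bounds involve only tail probabilities and pass to the limit
(`tendsto_gaussianTradeoff`), for every choice of the underlying distributions; monotonicity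
upgrades pointwise to uniform convergence. -/

theorem integrable_of_mem_Icc [IsFiniteMeasure P] {φ : Ω → ℝ} (hφ : Measurable φ)
    (h01 : ∀ ω, φ ω ∈ Icc (0 : ℝ) 1) : Integrable φ P :=
  Integrable.of_mem_Icc 0 1 hφ.aemeasurable (ae_of_all _ h01)

theorem integral_mem_Icc [IsProbabilityMeasure P] {φ : Ω → ℝ} (hφ : Measurable φ)
    (h01 : ∀ ω, φ ω ∈ Icc (0 : ℝ) 1) : ∫ ω, φ ω ∂P ∈ Icc (0 : ℝ) 1 := by
  refine ⟨integral_nonneg fun ω => (h01 ω).1, ?_⟩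
  calc ∫ ω, φ ω ∂P ≤ ∫ _, (1 : ℝ) ∂P :=
        integral_mono (integrable_of_mem_Icc hφ h01) (integrable_const _) fun ω => (h01 ω).2
    _ = 1 := by simp

theorem tradeoff_le [IsProbabilityMeasure Q] {α : ℝ} {φ : Ω → ℝ} (hφ : Measurable φ)
    (h01 : ∀ ω, φ ω ∈ Icc (0 : ℝ) 1) (hα : ∫ ω, φ ω ∂P ≤ α) :
    tradeoff P Q α ≤ 1 - ∫ ω, φ ω ∂Q := by
  refine csInf_le ⟨0, ?_⟩ ⟨φ, hφ, h01, hα, rfl⟩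
  rintro _ ⟨ψ, hψ, hψ01, -, rfl⟩
  linarith [(integral_mem_Icc (P := Q) hψ hψ01).2]

theorem tradeoff_le_of_measurableSet [IsProbabilityMeasure P] [IsProbabilityMeasure Q] {α : ℝ}
    {A : Set Ω} (hA : MeasurableSet A) (hα : P.real A ≤ α) :
    tradeoff P Q α ≤ 1 - Q.real A := by
  have h := tradeoff_le (P := P) (Q := Q) (α := α) (φ := A.indicator 1)
    (measurable_one.indicator hA) (fun ω => by by_cases h : ω ∈ A <;> simp [h])
    (by rwa [integral_indicator_one hA])
  rwa [integral_indicator_one hA] at h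

theorem le_tradeoff {α b : ℝ} (hα : 0 ≤ α)
    (h : ∀ φ : Ω → ℝ, Measurable φ → (∀ ω, φ ω ∈ Icc (0 : ℝ) 1) → ∫ ω, φ ω ∂P ≤ α →
      b ≤ 1 - ∫ ω, φ ω ∂Q) : b ≤ tradeoff P Q α := by
  refine le_csInf ⟨1 - ∫ _, (0 : ℝ) ∂Q, fun _ => 0, measurable_const, fun _ => by simp,
    by simpa using hα, rfl⟩ ?_
  rintro _ ⟨φ, hφ, h01, hφα, rfl⟩
  exact h φ hφ h01 hφα

theorem exists_test_of_tradeoff_lt {α b : ℝ} (hα : 0 ≤ α) (h : tradeoff P Q α < b) :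
    ∃ φ : Ω → ℝ, Measurable φ ∧ (∀ ω, φ ω ∈ Icc (0 : ℝ) 1) ∧ ∫ ω, φ ω ∂P ≤ α ∧
      1 - ∫ ω, φ ω ∂Q < b := by
  by_contra! hcon
  exact absurd (le_tradeoff hα hcon) (not_le.2 h)

theorem tradeoff_nonneg [IsProbabilityMeasure Q] {α : ℝ} (hα : 0 ≤ α) : 0 ≤ tradeoff P Q α :=
  le_tradeoff hα fun φ hφ h01 _ => by linarith [(integral_mem_Icc (P := Q) hφ h01).2]

theorem tradeoff_antitoneOn [IsProbabilityMeasure Q] : AntitoneOn (tradeoff P Q) (Ici 0) :=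
  fun _ ha _ _ hab => le_tradeoff ha fun _ hφ h01 hφα => tradeoff_le hφ h01 (hφα.trans hab)

theorem tradeoff_le_one_sub [IsProbabilityMeasure P] [IsProbabilityMeasure Q] {α : ℝ}
    (hα : α ∈ Icc (0 : ℝ) 1) : tradeoff P Q α ≤ 1 - α := by
  simpa using tradeoff_le (P := P) (Q := Q) (α := α) (φ := fun _ => α) measurable_const
    (fun _ => hα) (by simp)

theorem tradeoff_one [IsProbabilityMeasure P] [IsProbabilityMeasure Q] :
    tradeoff P Q 1 = 0 :=
  le_antisymm (by simpa using tradeoff_le_one_sub (P := P) (Q := Q) (α := 1) (by simp))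
    (tradeoff_nonneg zero_le_one)

theorem tradeoff_zero [IsProbabilityMeasure P] [IsProbabilityMeasure Q] (hQP : Q ≪ P) :
    tradeoff P Q 0 = 1 := by
  refine le_antisymm (by simpa using tradeoff_le_one_sub (P := P) (Q := Q) (α := 0) (by simp))
    (le_tradeoff le_rfl fun φ hφ h01 hφα => ?_)
  have h0 : φ =ᵐ[P] 0 := (integral_eq_zero_iff_of_nonneg (fun ω => (h01 ω).1)
    (integrable_of_mem_Icc hφ h01)).1 (le_antisymm hφα (integral_nonneg fun ω => (h01 ω).1))
  rw [integral_congr_ae (hQP.ae_eq h0)]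
  simp

/-- The indicator of a `P`-null set is a test of level zero, so it can have no power. -/
theorem absolutelyContinuous_of_tradeoff_zero [IsProbabilityMeasure P] [IsProbabilityMeasure Q]
    (h : tradeoff P Q 0 = 1) : Q ≪ P := by
  refine Measure.AbsolutelyContinuous.mk fun A hA hPA => ?_
  have h1 := tradeoff_le_of_measurableSet (P := P) (Q := Q) (α := 0) hA (by simp [Measure.real, hPA])
  have h2 : Q.real A = 0 := le_antisymm (by linarith) measureReal_nonneg
  exact (measureReal_eq_zero_iff).1 h2

theorem tradeoff_convexOn [IsProbabilityMeasure P] [IsProbabilityMeasure Q] :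
    ConvexOn ℝ (Icc 0 1) (tradeoff P Q) := by
  refine ⟨convex_Icc 0 1, fun x hx y hy a b ha hb hab => ?_⟩
  refine le_of_forall_pos_le_add fun ε hε => ?_
  obtain ⟨φ, hφ, hφ01, hφx, hφQ⟩ := exists_test_of_tradeoff_lt (P := P) (Q := Q) hx.1
    (lt_add_of_pos_right _ hε)
  obtain ⟨ψ, hψ, hψ01, hψy, hψQ⟩ := exists_test_of_tradeoff_lt (P := P) (Q := Q) hy.1
    (lt_add_of_pos_right _ hε)
  have hint : ∀ (μ : Measure Ω) [IsProbabilityMeasure μ],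
      ∫ ω, (a * φ ω + b * ψ ω) ∂μ = a * ∫ ω, φ ω ∂μ + b * ∫ ω, ψ ω ∂μ := fun μ _ => by
    rw [integral_add ((integrable_of_mem_Icc hφ hφ01).const_mul _)
      ((integrable_of_mem_Icc hψ hψ01).const_mul _), integral_const_mul, integral_const_mul]
  have h := tradeoff_le (P := P) (Q := Q) (α := a • x + b • y) (φ := fun ω => a * φ ω + b * ψ ω)
    (by fun_prop) (fun ω => convex_Icc (0 : ℝ) 1 (hφ01 ω) (hψ01 ω) ha hb hab)
    (by rw [hint]; simp only [smul_eq_mul]; gcongr)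
  rw [hint] at h
  refine h.trans ?_
  simp only [smul_eq_mul]
  have h1 := mul_le_mul_of_nonneg_left hφQ.le ha
  have h2 := mul_le_mul_of_nonneg_left hψQ.le hb
  have h3 : a * ε + b * ε = ε := by rw [← add_mul, hab, one_mul]
  linarith

/-- Replacing `φ` by `1 - φ` exchanges the two types of error. Optimal tests are not assumed to
exist, so one direction uses nearly optimal ones. -/
theorem tradeoff_swap_eq_tradeoffInv [IsProbabilityMeasure P] [IsProbabilityMeasure Q]
    {f : ℝ → ℝ} (hf : EqOn f (tradeoff P Q) (Icc 0 1)) (hpos : ∀ α ∈ Ico (0 : ℝ) 1, 0 < f α) :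
    EqOn (tradeoff Q P) (tradeoffInv f) (Icc 0 1) := by
  intro β hβ
  have hsub : ∀ (φ : Ω → ℝ), Measurable φ → (∀ ω, φ ω ∈ Icc (0 : ℝ) 1) →
      ∀ (μ : Measure Ω) [IsProbabilityMeasure μ], ∫ ω, (1 - φ ω) ∂μ = 1 - ∫ ω, φ ω ∂μ :=
    fun φ hφ h01 μ _ => by
      rw [integral_sub (integrable_const _) (integrable_of_mem_Icc hφ h01)]; simp
  have hone : (1 : ℝ) ∈ {α : ℝ | α ∈ Icc (0 : ℝ) 1 ∧ f α ≤ β} :=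
    ⟨by simp, by rw [hf (by simp), tradeoff_one]; exact hβ.1⟩
  have hbdd : BddBelow {α : ℝ | α ∈ Icc (0 : ℝ) 1 ∧ f α ≤ β} := ⟨0, fun α hα => hα.1.1⟩
  apply le_antisymm
  · refine le_csInf ⟨1, hone⟩ ?_
    rintro α ⟨hα, hfα⟩
    rcases hα.2.eq_or_lt with rfl | hα1
    · exact (tradeoff_le_one_sub hβ).trans (by linarith [hβ.1])
    have hβ0 : 0 < β := (hpos α ⟨hα.1, hα1⟩).trans_le hfα
    refine le_of_forall_pos_le_add fun ε hε => ?_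
    rw [hf hα] at hfα
    -- Slack proportional to `β`: shrinking `1 - φ` by the factor `(1 + ε)⁻¹` brings its level back
    -- to `β`, at a cost of at most `ε`.
    have hεβ : 0 < ε * β := mul_pos hε hβ0
    obtain ⟨φ, hφ, h01, hφα, hφQ⟩ := exists_test_of_tradeoff_lt (P := P) (Q := Q) hα.1
      (hfα.trans_lt (lt_add_of_pos_right _ hεβ))
    have hε1 : 0 < 1 + ε := by linarith
    have hc : 0 ≤ (1 + ε)⁻¹ ∧ (1 + ε)⁻¹ ≤ 1 :=
      ⟨by positivity, inv_le_one_of_one_le₀ (by linarith)⟩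
    have hcm : (1 + ε)⁻¹ * (1 + ε) = 1 := inv_mul_cancel₀ hε1.ne'
    set c := (1 + ε)⁻¹ with hcdef
    have h := tradeoff_le (P := Q) (Q := P) (α := β) (φ := fun ω => c * (1 - φ ω))
      (by fun_prop)
      (fun ω => ⟨mul_nonneg hc.1 (by linarith [(h01 ω).2]),
        mul_le_one₀ hc.2 (by linarith [(h01 ω).2]) (by linarith [(h01 ω).1])⟩)
      (by
        rw [integral_const_mul, hsub φ hφ h01]
        calc c * (1 - ∫ ω, φ ω ∂Q) ≤ c * (β + ε * β) := by gcongr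
          _ = β * (c * (1 + ε)) := by ring
          _ ≤ β := by rw [hcm, mul_one])
    rw [integral_const_mul, hsub φ hφ h01] at h
    have hφ1 := (integral_mem_Icc (P := P) hφ h01)
    have h1c : 1 - c ≤ ε := by nlinarith
    have : c * ∫ ω, φ ω ∂P ≤ ∫ ω, φ ω ∂P := mul_le_of_le_one_left hφ1.1 hc.2
    linarith
  · refine le_tradeoff hβ.1 fun φ hφ h01 hφβ => csInf_le hbdd ⟨?_, ?_⟩
    · have := integral_mem_Icc (P := P) hφ h01
      exact ⟨by linarith [this.2], by linarith [this.1]⟩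
    · have := integral_mem_Icc (P := P) hφ h01
      rw [hf ⟨by linarith [this.2], by linarith [this.1]⟩]
      have h := tradeoff_le (P := P) (Q := Q) (α := 1 - ∫ ω, φ ω ∂P) (φ := fun ω => 1 - φ ω)
        (by fun_prop) (fun ω => ⟨by linarith [(h01 ω).2], by linarith [(h01 ω).1]⟩)
        (hsub φ hφ h01 P).le
      rw [hsub φ hφ h01] at h
      linarith

end Tradeoff

/-! ### The Neyman-Pearson lemma and the law of the log-likelihood ratio. -/

section LogLikelihood

variable {Ω : Type*} [MeasurableSpace Ω] {P Q : Measure Ω} {ℓ : Ω → ℝ}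

/-- `ℓ` is a version of the log-likelihood ratio `log (dQ/dP)`. -/
def IsLogLikelihood (P Q : Measure Ω) (ℓ : Ω → ℝ) : Prop :=
  Measurable ℓ ∧ Q = P.withDensity fun ω => ENNReal.ofReal (Real.exp (ℓ ω))

theorem isLogLikelihood_llr [IsProbabilityMeasure P] [IsProbabilityMeasure Q] (hPQ : P ≪ Q)
    (hQP : Q ≪ P) : IsLogLikelihood P Q (llr Q P) := by
  refine ⟨measurable_llr Q P, ?_⟩
  conv_lhs => rw [← Measure.withDensity_rnDeriv_eq Q P hQP]
  refine withDensity_congr_ae ?_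
  filter_upwards [exp_llr_of_ac' Q P hPQ, Measure.rnDeriv_lt_top Q P] with ω h1 h2
  rw [h1, ENNReal.ofReal_toReal h2.ne]

namespace IsLogLikelihood

theorem integral_eq (h : IsLogLikelihood P Q ℓ) (φ : Ω → ℝ) :
    ∫ ω, φ ω ∂Q = ∫ ω, Real.exp (ℓ ω) * φ ω ∂P := by
  rw [h.2, integral_withDensity_eq_integral_toReal_smul (by have := h.1; fun_prop)
    (ae_of_all _ fun _ => ENNReal.ofReal_lt_top)]
  refine integral_congr_ae (ae_of_all _ fun ω => ?_)
  simp [ENNReal.toReal_ofReal (Real.exp_pos _).le]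

theorem integrable_exp_mul (h : IsLogLikelihood P Q ℓ) {φ : Ω → ℝ} (hφ : Integrable φ Q) :
    Integrable (fun ω => Real.exp (ℓ ω) * φ ω) P := by
  rw [h.2, integrable_withDensity_iff_integrable_smul' (by have := h.1; fun_prop)
    (ae_of_all _ fun _ => ENNReal.ofReal_lt_top)] at hφ
  refine hφ.congr (ae_of_all _ fun ω => ?_)
  simp [ENNReal.toReal_ofReal (Real.exp_pos _).le]

theorem integrable_exp [IsProbabilityMeasure Q] (h : IsLogLikelihood P Q ℓ) :
    Integrable (fun ω => Real.exp (ℓ ω)) P := by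
  simpa using h.integrable_exp_mul (integrable_const (1 : ℝ))

theorem integral_exp [IsProbabilityMeasure Q] (h : IsLogLikelihood P Q ℓ) :
    ∫ ω, Real.exp (ℓ ω) ∂P = 1 := by
  simpa using (h.integral_eq fun _ => 1).symm

theorem measurableSet_lt (h : IsLogLikelihood P Q ℓ) (c : ℝ) : MeasurableSet {ω | c < ℓ ω} :=
  h.1 measurableSet_Ioi

/-- The weak duality half of the Neyman-Pearson lemma. -/
theorem le_tradeoff [IsProbabilityMeasure P] [IsProbabilityMeasure Q]
    (h : IsLogLikelihood P Q ℓ) (c : ℝ) {α : ℝ} (hα : 0 ≤ α) :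
    1 - Real.exp c * α - (Q.real {ω | c < ℓ ω} - Real.exp c * P.real {ω | c < ℓ ω}) ≤
      tradeoff P Q α := by
  refine _root_.le_tradeoff hα fun φ hφ h01 hφα => ?_
  set A := {ω | c < ℓ ω}
  have hA : MeasurableSet A := h.measurableSet_lt c
  have hint : ∀ ψ : Ω → ℝ, Measurable ψ → (∀ ω, ψ ω ∈ Icc (0 : ℝ) 1) →
      Integrable (fun ω => (Real.exp (ℓ ω) - Real.exp c) * ψ ω) P ∧
      ∫ ω, (Real.exp (ℓ ω) - Real.exp c) * ψ ω ∂P =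
        ∫ ω, ψ ω ∂Q - Real.exp c * ∫ ω, ψ ω ∂P := fun ψ hψ hψ01 => by
    have i1 := h.integrable_exp_mul (integrable_of_mem_Icc hψ hψ01)
    have i2 := (integrable_of_mem_Icc (P := P) hψ hψ01).const_mul (Real.exp c)
    simp_rw [sub_mul]
    exact ⟨i1.sub i2, by rw [integral_sub i1 i2, integral_const_mul, h.integral_eq]⟩
  obtain ⟨i1, e1⟩ := hint φ hφ h01
  obtain ⟨i2, e2⟩ := hint (A.indicator 1) (measurable_one.indicator hA)
    (fun ω => by by_cases h : ω ∈ A <;> simp [h])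
  have hle := integral_mono i1 i2 fun ω => by
    by_cases hω : c < ℓ ω
    · have : A.indicator (1 : Ω → ℝ) ω = 1 := by simp [A, hω]
      simp only [this]
      exact mul_le_mul_of_nonneg_left (h01 ω).2 (sub_nonneg.2 (Real.exp_le_exp.2 hω.le))
    · have : A.indicator (1 : Ω → ℝ) ω = 0 := by simp [A, hω]
      simp only [this, mul_zero]
      exact mul_nonpos_of_nonpos_of_nonneg (sub_nonpos.2 (Real.exp_le_exp.2 (not_lt.1 hω)))
        (h01 ω).1
  rw [e1, e2, integral_indicator_one hA, integral_indicator_one hA] at hle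
  have := mul_le_mul_of_nonneg_left hφα (Real.exp_pos c).le
  linarith

/-- The Neyman-Pearson lemma for nonrandomized likelihood ratio tests. -/
theorem tradeoff_eq [IsProbabilityMeasure P] [IsProbabilityMeasure Q]
    (h : IsLogLikelihood P Q ℓ) (c : ℝ) :
    tradeoff P Q (P.real {ω | c < ℓ ω}) = 1 - Q.real {ω | c < ℓ ω} := by
  refine le_antisymm (tradeoff_le_of_measurableSet (h.measurableSet_lt c) le_rfl) ?_
  have := h.le_tradeoff c (α := P.real {ω | c < ℓ ω}) measureReal_nonneg
  linarith

/-- At the point `P(ℓ > c)` the trade-off function has a supporting line of slope `-exp c`. -/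
theorem supporting_line [IsProbabilityMeasure P] [IsProbabilityMeasure Q]
    (h : IsLogLikelihood P Q ℓ) (c : ℝ) {α : ℝ} (hα : 0 ≤ α) :
    tradeoff P Q (P.real {ω | c < ℓ ω}) - Real.exp c * (α - P.real {ω | c < ℓ ω}) ≤
      tradeoff P Q α := by
  rw [h.tradeoff_eq c]
  linarith [h.le_tradeoff c hα]

end IsLogLikelihood

/-- Approximating `c` strictly from above replaces `Ici` by `Ioi` in the second bound. This form
tolerates atoms of the likelihood ratio. -/
theorem measure_eq_of_Ioi_le_of_le_Ici {μ ν : Measure ℝ} [IsProbabilityMeasure μ]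
    [IsProbabilityMeasure ν] (h1 : ∀ c, μ (Ioi c) ≤ ν (Ioi c)) (h2 : ∀ c, ν (Ioi c) ≤ μ (Ici c)) :
    μ = ν := by
  have hIoi : ∀ c, μ (Ioi c) = ν (Ioi c) := fun c => by
    refine le_antisymm (h1 c) ?_
    obtain ⟨u, hu, huc, hulim⟩ := exists_seq_strictAnti_tendsto c
    have hU : Ioi c = ⋃ n, Ioi (u n) := by
      ext x
      simp only [mem_Ioi, mem_iUnion]
      exact ⟨fun hx => (hulim.eventually_lt_const hx).exists, fun ⟨n, hn⟩ => (huc n).trans hn⟩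
    have hmono : Monotone fun n => Ioi (u n) := fun a b hab => Ioi_subset_Ioi (hu.antitone hab)
    conv_lhs => rw [hU, hmono.measure_iUnion]
    exact iSup_le fun n => (h2 _).trans (measure_mono fun x hx => (huc n).trans_le hx)
  refine Measure.ext_of_Iic μ ν fun c => ?_
  rw [← compl_Ioi, prob_compl_eq_one_sub measurableSet_Ioi,
    prob_compl_eq_one_sub measurableSet_Ioi, hIoi]

/-- The Lebesgue measure on `(0, 1)`. -/
noncomputable abbrev unitVolume : Measure ℝ := volume.restrict (Ioo (0 : ℝ) 1)

instance : IsProbabilityMeasure unitVolume := ⟨by simp⟩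

theorem deriv_nonpos_of_antitoneOn_Icc {f : ℝ → ℝ} {x : ℝ}
    (ha : AntitoneOn f (Icc 0 1)) (hx : x ∈ Ioo (0 : ℝ) 1) : deriv f x ≤ 0 := by
  rw [← derivWithin_of_mem_nhds (Icc_mem_nhds hx.1 hx.2)]
  exact ha.derivWithin_nonpos

theorem unitVolume_Iio {a : ℝ} (ha : a ∈ Icc (0 : ℝ) 1) :
    unitVolume (Iio a) = ENNReal.ofReal a := by
  rw [Measure.restrict_apply measurableSet_Iio,
    show Iio a ∩ Ioo 0 1 = Ioo 0 a by ext x; simp; grind, Real.volume_Ioo, sub_zero]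

theorem unitVolume_Iic {a : ℝ} (ha : a ∈ Icc (0 : ℝ) 1) :
    unitVolume (Iic a) = ENNReal.ofReal a := by
  rw [← unitVolume_Iio ha]
  exact measure_congr Iio_ae_eq_Iic.symm

/-- The log-likelihood ratio under `P` is distributed as `log |f'(U)|`, for `U` uniform on
`(0, 1)`. -/
theorem IsLogLikelihood.map_eq [IsProbabilityMeasure P] [IsProbabilityMeasure Q]
    (h : IsLogLikelihood P Q ℓ) {f : ℝ → ℝ} (hf : EqOn f (tradeoff P Q) (Icc 0 1))
    (hne : ∀ᵐ x ∂unitVolume, deriv f x ≠ 0) :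
    unitVolume.map (fun x => Real.log |deriv f x|) = P.map ℓ := by
  have hYm : Measurable fun x => Real.log |deriv f x| := (measurable_deriv f).abs.log
  have hconv : ConvexOn ℝ (Icc 0 1) f := tradeoff_convexOn.congr hf.symm
  have hanti : AntitoneOn f (Icc 0 1) :=
    (tradeoff_antitoneOn.mono Icc_subset_Ici_self).congr hf.symm
  -- Convexity compares the tangent slope at `x` with the chord to `a = P(ℓ > c)`, and the
  -- supporting line at `a` compares that chord with `-exp c`. Both `x < a` and `x ≤ a` have uniform
  -- probability `a`, so the undecided point `x = a` is harmless.
  have hside : ∀ᵐ x ∂unitVolume, ∀ c,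
      (x < P.real {ω | c < ℓ ω} → c ≤ Real.log |deriv f x|) ∧
      (P.real {ω | c < ℓ ω} < x → Real.log |deriv f x| ≤ c) := by
    filter_upwards [hne, ae_restrict_mem measurableSet_Ioo] with x hx0 hx c
    have hd : DifferentiableAt ℝ f x := differentiableAt_of_deriv_ne_zero hx0
    have hxI := Ioo_subset_Icc_self hx
    set a := P.real {ω | c < ℓ ω} with ha
    have haI : a ∈ Icc (0 : ℝ) 1 := ⟨measureReal_nonneg, measureReal_le_one⟩
    have hline := h.supporting_line c hxI.1
    rw [← hf haI, ← hf hxI, ← ha] at hline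
    have hneg : deriv f x ≤ 0 := deriv_nonpos_of_antitoneOn_Icc hanti hx
    have hpos : 0 < -deriv f x := by
      rcases hneg.lt_or_eq with h | h
      · linarith
      · exact absurd h hx0
    rw [abs_of_nonpos hneg, Real.le_log_iff_exp_le hpos, Real.log_le_iff_le_exp hpos]
    constructor <;> intro hxa
    · have := hconv.deriv_le_slope hxI haI hxa hd
      rw [slope_def_field, le_div_iff₀ (by linarith)] at this
      nlinarith
    · have := hconv.slope_le_deriv haI hxI hxa hd
      rw [slope_def_field, div_le_iff₀ (by linarith)] at this
      nlinarith
  have := Measure.isProbabilityMeasure_map (μ := P) h.1.aemeasurable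
  have := Measure.isProbabilityMeasure_map (μ := unitVolume) hYm.aemeasurable
  have haI : ∀ c, P.real {ω | c < ℓ ω} ∈ Icc (0 : ℝ) 1 :=
    fun c => ⟨measureReal_nonneg, measureReal_le_one⟩
  have hP : ∀ c, P.map ℓ (Ioi c) = ENNReal.ofReal (P.real {ω | c < ℓ ω}) := fun c => by
    rw [Measure.map_apply h.1 measurableSet_Ioi, ofReal_measureReal]; rfl
  refine measure_eq_of_Ioi_le_of_le_Ici (fun c => ?_) (fun c => ?_)
  · rw [hP, ← unitVolume_Iic (haI c), Measure.map_apply hYm measurableSet_Ioi]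
    refine measure_mono_ae ?_
    filter_upwards [hside] with x hx hxc
    exact not_lt.1 fun hlt => absurd ((hx c).2 hlt) (not_le.2 hxc)
  · rw [hP, ← unitVolume_Iio (haI c), Measure.map_apply hYm measurableSet_Ici]
    refine measure_mono_ae ?_
    filter_upwards [hside] with x hx hxc
    exact (hx c).1 hxc

end LogLikelihood

/-! ### The functionals `ν` as moments of `log |f'(U)|`. -/

section Moments

variable {f : ℝ → ℝ}

theorem logAbsDeriv_eq (f : ℝ → ℝ) (x : ℝ) :
    logAbsDeriv f x = if deriv f x = 0 then ⊥ else ((Real.log |deriv f x| : ℝ) : EReal) := by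
  rw [logAbsDeriv, ENNReal.log_ofReal]
  simp only [abs_nonpos_iff]

theorem measurable_log_abs_deriv (f : ℝ → ℝ) : Measurable fun x => Real.log |deriv f x| :=
  (measurable_deriv f).abs.log

/-- Where `f' = 0` the integrand of `nu3` is infinite. This also gives differentiability almost
everywhere, since `deriv` is zero by default at other points. -/
theorem ae_deriv_ne_zero (h : nu3 f ≠ ⊤) : ∀ᵐ x ∂unitVolume, deriv f x ≠ 0 := by
  have hm : Measurable fun x => (logAbsDeriv f x).abs ^ 3 := by
    have : (fun x => (logAbsDeriv f x).abs ^ 3) = fun x =>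
        if deriv f x = 0 then ⊤ else ENNReal.ofReal |(Real.log |deriv f x|)| ^ 3 := by
      ext x
      rw [logAbsDeriv_eq]
      split_ifs <;> simp [EReal.abs_def]
    rw [this]
    exact Measurable.ite (measurable_deriv f (measurableSet_singleton 0)) measurable_const
      ((measurable_log_abs_deriv f).abs.ennreal_ofReal.pow_const 3)
  filter_upwards [ae_lt_top hm h] with x hx hx0
  simp [logAbsDeriv_eq, hx0] at hx

theorem nu2_eq_lintegral (h : ∀ᵐ x ∂unitVolume, deriv f x ≠ 0) :
    nu2 f = ∫⁻ x, ENNReal.ofReal (Real.log |deriv f x| ^ 2) ∂unitVolume := by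
  refine lintegral_congr_ae ?_
  filter_upwards [h] with x hx
  rw [logAbsDeriv_eq, if_neg hx, EReal.abs_def, ← ENNReal.ofReal_pow (abs_nonneg _), sq_abs]

theorem nu3_eq_lintegral (h : ∀ᵐ x ∂unitVolume, deriv f x ≠ 0) :
    nu3 f = ∫⁻ x, ENNReal.ofReal (|(Real.log |deriv f x|)| ^ 3) ∂unitVolume := by
  refine lintegral_congr_ae ?_
  filter_upwards [h] with x hx
  rw [logAbsDeriv_eq, if_neg hx, EReal.abs_def, ← ENNReal.ofReal_pow (abs_nonneg _)]

theorem memLp_log_abs_deriv (h : nu3 f ≠ ⊤) :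
    MemLp (fun x => Real.log |deriv f x|) 3 unitVolume := by
  refine ⟨(measurable_log_abs_deriv f).aestronglyMeasurable, ?_⟩
  rw [eLpNorm_lt_top_iff_lintegral_rpow_enorm_lt_top (by simp) (by simp)]
  refine lt_of_eq_of_lt ?_ (lt_top_iff_ne_top.2 h)
  rw [nu3_eq_lintegral (ae_deriv_ne_zero h)]
  refine lintegral_congr fun x => ?_
  rw [ENNReal.ofReal_pow (abs_nonneg _), Real.enorm_eq_ofReal_abs]
  norm_num

/-- The law of `log |f'(U)|`, for `U` uniform on `(0, 1)`. -/
noncomputable def logDerivLaw (f : ℝ → ℝ) : Measure ℝ :=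
  unitVolume.map fun x => Real.log |deriv f x|

instance (f : ℝ → ℝ) : IsProbabilityMeasure (logDerivLaw f) :=
  Measure.isProbabilityMeasure_map (measurable_log_abs_deriv f).aemeasurable

theorem memLp_logDerivLaw (h : nu3 f ≠ ⊤) : MemLp (fun x => x) 3 (logDerivLaw f) :=
  (memLp_map_measure_iff aestronglyMeasurable_id
    (measurable_log_abs_deriv f).aemeasurable).2 (memLp_log_abs_deriv h)

theorem integrable_id_of_memLp_three {μ : Measure ℝ} [IsProbabilityMeasure μ]
    (h : MemLp (fun x => x) 3 μ) : Integrable (fun x => x) μ :=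
  h.integrable (by norm_num)

theorem integrable_sq_of_memLp_three {μ : Measure ℝ} [IsProbabilityMeasure μ]
    (h : MemLp (fun x => x) 3 μ) : Integrable (fun x => x ^ 2) μ :=
  (h.mono_exponent (q := 3) (p := 2) (by norm_num)).integrable_sq

theorem integrable_abs_cube_of_memLp_three {μ : Measure ℝ} [IsProbabilityMeasure μ]
    (h : MemLp (fun x => x) 3 μ) : Integrable (fun x => |x| ^ 3) μ := by
  simpa using h.integrable_norm_pow (p := 3) (by norm_num)

theorem nu2_eq_ofReal (h : nu3 f ≠ ⊤) :
    nu2 f = ENNReal.ofReal (∫ x, x ^ 2 ∂logDerivLaw f) := by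
  rw [nu2_eq_lintegral (ae_deriv_ne_zero h), ofReal_integral_eq_lintegral_ofReal
    (integrable_sq_of_memLp_three (memLp_logDerivLaw h)) (ae_of_all _ fun x => sq_nonneg x),
    logDerivLaw, lintegral_map (by fun_prop) (measurable_log_abs_deriv f)]

theorem nu3_eq_ofReal (h : nu3 f ≠ ⊤) :
    nu3 f = ENNReal.ofReal (∫ x, |x| ^ 3 ∂logDerivLaw f) := by
  rw [nu3_eq_lintegral (ae_deriv_ne_zero h), ofReal_integral_eq_lintegral_ofReal
    (integrable_abs_cube_of_memLp_three (memLp_logDerivLaw h))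
    (ae_of_all _ fun x => by positivity),
    logDerivLaw, lintegral_map (by fun_prop) (measurable_log_abs_deriv f)]

theorem nu1_eq_coe (h : nu3 f ≠ ⊤) :
    nu1 f = ((-∫ x, x ∂logDerivLaw f : ℝ) : EReal) := by
  have hY : Integrable (fun x => Real.log |deriv f x|) unitVolume :=
    (memLp_log_abs_deriv h).integrable (by norm_num)
  have e1 : ∫⁻ x in Ioo (0 : ℝ) 1, (-logAbsDeriv f x).toENNReal =
      ∫⁻ x, ENNReal.ofReal (-Real.log |deriv f x|) ∂unitVolume := by
    refine lintegral_congr_ae ?_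
    filter_upwards [ae_deriv_ne_zero h] with x hx
    rw [logAbsDeriv_eq, if_neg hx, ← EReal.coe_neg, EReal.real_coe_toENNReal]
  have e2 : ∫⁻ x in Ioo (0 : ℝ) 1, (logAbsDeriv f x).toENNReal =
      ∫⁻ x, ENNReal.ofReal (Real.log |deriv f x|) ∂unitVolume := by
    refine lintegral_congr_ae ?_
    filter_upwards [ae_deriv_ne_zero h] with x hx
    rw [logAbsDeriv_eq, if_neg hx, EReal.real_coe_toENNReal]
  have f1 := hY.neg.lintegral_lt_top
  have f2 := hY.lintegral_lt_top
  simp only [Pi.neg_apply] at f1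
  rw [nu1, e1, e2, logDerivLaw, integral_map (f := fun x => x)
    (measurable_log_abs_deriv f).aemeasurable (by fun_prop), integral_eq_lintegral_pos_part_sub_lintegral_neg_part hY,
    ← EReal.coe_ennreal_toReal f1.ne, ← EReal.coe_ennreal_toReal f2.ne, ← EReal.coe_sub, neg_sub]

end Moments

/-! ### Consequences of symmetry. -/

section Symmetric

variable {f : ℝ → ℝ} {Ω : Type*} [MeasurableSpace Ω] {P Q : Measure Ω}

/-- A zero before `1` would force `f`, and hence `f'`, to vanish on a whole interval. -/
theorem pos_of_nu3_ne_top [IsProbabilityMeasure Q] (hf : EqOn f (tradeoff P Q) (Icc 0 1)) (h : nu3 f ≠ ⊤) {α : ℝ}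
    (hα : α ∈ Ico (0 : ℝ) 1) : 0 < f α := by
  have hαI := Ico_subset_Icc_self hα
  by_contra! hle
  have hzero : ∀ x ∈ Ioo α 1, f x = 0 := fun x hx => by
    have hxI : x ∈ Icc (0 : ℝ) 1 := ⟨hα.1.trans hx.1.le, hx.2.le⟩
    rw [hf hxI]
    refine le_antisymm ?_ (tradeoff_nonneg hxI.1)
    rw [hf hαI] at hle
    exact (tradeoff_antitoneOn hα.1 hxI.1 hx.1.le).trans hle
  have hd : ∀ x ∈ Ioo α 1, deriv f x = 0 := fun x hx => by
    have : f =ᶠ[𝓝 x] fun _ => 0 := by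
      filter_upwards [Ioo_mem_nhds hx.1 hx.2] with y hy using hzero y hy
    rw [this.deriv_eq, deriv_const]
  have hnull : unitVolume (Ioo α 1) = 0 :=
    measure_mono_null (fun x hx => by simpa using hd x hx) (ae_iff.1 (ae_deriv_ne_zero h))
  rw [Measure.restrict_apply measurableSet_Ioo,
    inter_eq_left.2 (Ioo_subset_Ioo_left hα.1), Real.volume_Ioo, ENNReal.ofReal_eq_zero] at hnull
  linarith [hα.2]

variable [IsProbabilityMeasure P] [IsProbabilityMeasure Q]

theorem eqOn_tradeoff_swap (hf : EqOn f (tradeoff P Q) (Icc 0 1))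
    (hsymm : EqOn f (tradeoffInv f) (Icc 0 1)) (h : nu3 f ≠ ⊤) :
    EqOn f (tradeoff Q P) (Icc 0 1) := fun _ hx =>
  (hsymm hx).trans (tradeoff_swap_eq_tradeoffInv hf (fun _ => pos_of_nu3_ne_top hf h) hx).symm

/-- By symmetry `f 0` is the first zero of `f`, and positivity places it at `1`. -/
theorem apply_zero_of_symmetric (hf : EqOn f (tradeoff P Q) (Icc 0 1))
    (hsymm : EqOn f (tradeoffInv f) (Icc 0 1)) (h : nu3 f ≠ ⊤) : f 0 = 1 := by
  have hset : {α : ℝ | α ∈ Icc (0 : ℝ) 1 ∧ f α ≤ 0} = {1} := by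
    ext α
    constructor
    · rintro ⟨hα, hfα⟩
      by_contra hne
      exact absurd (pos_of_nu3_ne_top hf h ⟨hα.1, lt_of_le_of_ne hα.2 hne⟩) (not_lt.2 hfα)
    · rintro rfl
      exact ⟨by simp, by rw [hf (by simp), tradeoff_one]⟩
  rw [hsymm (by simp), tradeoffInv, hset, csInf_singleton]

theorem absolutelyContinuous_of_symmetric (hf : EqOn f (tradeoff P Q) (Icc 0 1))
    (hsymm : EqOn f (tradeoffInv f) (Icc 0 1)) (h : nu3 f ≠ ⊤) : Q ≪ P :=
  absolutelyContinuous_of_tradeoff_zero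
    (by rw [← hf (by simp), apply_zero_of_symmetric hf hsymm h])

theorem isLogLikelihood_of_symmetric (hf : EqOn f (tradeoff P Q) (Icc 0 1))
    (hsymm : EqOn f (tradeoffInv f) (Icc 0 1)) (h : nu3 f ≠ ⊤) :
    IsLogLikelihood P Q (llr Q P) :=
  isLogLikelihood_llr
    (absolutelyContinuous_of_symmetric (eqOn_tradeoff_swap hf hsymm h) hsymm h)
    (absolutelyContinuous_of_symmetric hf hsymm h)

theorem map_llr_left_of_symmetric (hf : EqOn f (tradeoff P Q) (Icc 0 1))
    (hsymm : EqOn f (tradeoffInv f) (Icc 0 1)) (h : nu3 f ≠ ⊤) :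
    P.map (llr Q P) = logDerivLaw f :=
  ((isLogLikelihood_of_symmetric hf hsymm h).map_eq hf (ae_deriv_ne_zero h)).symm

/-- The pair `(Q, P)` has the same trade-off function, and its log-likelihood ratio is the negative
of that of `(P, Q)`. -/
theorem map_llr_right_of_symmetric (hf : EqOn f (tradeoff P Q) (Icc 0 1))
    (hsymm : EqOn f (tradeoffInv f) (Icc 0 1)) (h : nu3 f ≠ ⊤) :
    Q.map (llr Q P) = (logDerivLaw f).map (fun x => -x) := by
  rw [← map_llr_left_of_symmetric (eqOn_tradeoff_swap hf hsymm h) hsymm h,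
    Measure.map_map measurable_neg (measurable_llr P Q)]
  refine Measure.map_congr ?_
  filter_upwards [neg_llr (absolutelyContinuous_of_symmetric hf hsymm h)] with x hx
  simp [← hx]

/-- Nonnegativity of relative entropy. Since the means share a sign, convergence of their sum bounds
the sum of their absolute values. -/
theorem integral_logDerivLaw_nonpos (hf : EqOn f (tradeoff P Q) (Icc 0 1))
    (hsymm : EqOn f (tradeoffInv f) (Icc 0 1)) (h : nu3 f ≠ ⊤) :
    ∫ x, x ∂logDerivLaw f ≤ 0 := by
  have hL := isLogLikelihood_of_symmetric hf hsymm h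
  have hmap := map_llr_left_of_symmetric hf hsymm h
  have hint := integrable_id_of_memLp_three (memLp_logDerivLaw h)
  rw [← hmap] at hint ⊢
  rw [integral_map (f := fun x => x) hL.1.aemeasurable (by fun_prop)]
  have hint' : Integrable (llr Q P) P :=
    (integrable_map_measure aestronglyMeasurable_id hL.1.aemeasurable).1 hint
  calc ∫ x, llr Q P x ∂P ≤ ∫ x, (Real.exp (llr Q P x) - 1) ∂P :=
        integral_mono hint' (hL.integrable_exp.sub (integrable_const _)) fun x => by
          linarith [Real.add_one_le_exp (llr Q P x)]
    _ = 0 := by rw [integral_sub hL.integrable_exp (integrable_const _), hL.integral_exp]; simp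

end Symmetric

/-! ### A Lyapunov central limit theorem for triangular arrays. -/

section CentralLimit

open Complex (I)

/-- Taylor's bound serves for `|x| ≤ 1`. Beyond that, the triangle inequality gives `2 + |x| + |x|²
/ 2`, whence the constant `4`. -/
theorem norm_cexp_mul_I_sub_taylor_le (x : ℝ) :
    ‖Complex.exp (x * I) - 1 - (x * I - x ^ 2 / 2)‖ ≤ 4 * |x| ^ 3 := by
  have hxI : ‖(x * I : ℂ)‖ = |x| := by simp
  rcases le_total |x| 1 with hx | hx
  · have h := Complex.exp_bound (x := x * I) (by rwa [hxI]) (n := 3) (by norm_num)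
    rw [hxI] at h
    have e : ∑ m ∈ Finset.range 3, (x * I : ℂ) ^ m / (m.factorial : ℂ) =
        1 + (x * I - x ^ 2 / 2) := by
      simp only [Finset.sum_range_succ, Finset.sum_range_zero, mul_pow, Complex.I_sq]
      norm_num [Nat.factorial]
      ring
    rw [e, ← sub_sub] at h
    refine h.trans ?_
    rw [mul_comm]
    refine mul_le_mul_of_nonneg_right ?_ (by positivity)
    norm_num [Nat.factorial]
  · have h1 : ‖Complex.exp (x * I)‖ = 1 := Complex.norm_exp_ofReal_mul_I x
    have h2 : ‖(x * I - x ^ 2 / 2 : ℂ)‖ ≤ |x| + |x| ^ 2 / 2 := by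
      refine (norm_sub_le _ _).trans ?_
      rw [hxI]
      simp
    calc _ ≤ ‖Complex.exp (x * I)‖ + ‖(1 : ℂ)‖ + ‖(x * I - x ^ 2 / 2 : ℂ)‖ :=
          (norm_sub_le _ _).trans (by gcongr; exact norm_sub_le _ _)
      _ ≤ 1 + 1 + (|x| + |x| ^ 2 / 2) := by rw [h1, norm_one]; gcongr
      _ ≤ 4 * |x| ^ 3 := by
        have : |x| ≤ |x| ^ 2 := by nlinarith
        have : |x| ^ 2 ≤ |x| ^ 3 := pow_le_pow_right₀ hx (by norm_num)
        nlinarith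

theorem norm_charFun_sub_taylor_le {μ : Measure ℝ} [IsProbabilityMeasure μ]
    (h : MemLp (fun x => x) 3 μ) (t : ℝ) :
    ‖charFun μ t - 1 - (((t * ∫ x, x ∂μ : ℝ) : ℂ) * I - ((t ^ 2 * ∫ x, x ^ 2 ∂μ : ℝ) : ℂ) / 2)‖ ≤
      4 * |t| ^ 3 * ∫ x, |x| ^ 3 ∂μ := by
  have i1 : Integrable (fun x : ℝ => ((t * x : ℝ) : ℂ) * I) μ :=
    (((integrable_id_of_memLp_three h).const_mul t).ofReal).mul_const I
  have i2 : Integrable (fun x : ℝ => ((t ^ 2 * x ^ 2 : ℝ) : ℂ) / 2) μ :=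
    (((integrable_sq_of_memLp_three h).const_mul (t ^ 2)).ofReal).div_const 2
  have i0 : Integrable (fun x : ℝ => Complex.exp ((t * x : ℝ) * I)) μ :=
    Integrable.of_bound (by fun_prop) 1
      (ae_of_all _ fun x => (Complex.norm_exp_ofReal_mul_I (t * x)).le)
  have e : charFun μ t - 1 - (((t * ∫ x, x ∂μ : ℝ) : ℂ) * I -
      ((t ^ 2 * ∫ x, x ^ 2 ∂μ : ℝ) : ℂ) / 2) =
      ∫ x : ℝ, (Complex.exp ((t * x : ℝ) * I) - 1 -
        (((t * x : ℝ) : ℂ) * I - ((t * x : ℝ) : ℂ) ^ 2 / 2)) ∂μ := by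
    have : ∀ x : ℝ, ((t * x : ℝ) : ℂ) ^ 2 / 2 = ((t ^ 2 * x ^ 2 : ℝ) : ℂ) / 2 := fun x => by
      push_cast; ring
    simp_rw [this]
    have i01 : Integrable (fun x : ℝ => Complex.exp ((t * x : ℝ) * I) - 1) μ :=
      i0.sub (integrable_const 1)
    have i12 : Integrable (fun x : ℝ => ((t * x : ℝ) : ℂ) * I - ((t ^ 2 * x ^ 2 : ℝ) : ℂ) / 2) μ :=
      i1.sub i2
    rw [integral_sub i01 i12, integral_sub i0 (integrable_const _),
      integral_sub i1 i2, integral_mul_const, integral_div, integral_complex_ofReal,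
      integral_complex_ofReal, integral_const_mul, integral_const_mul, charFun_apply_real]
    simp
  rw [e]
  calc _ ≤ ∫ x : ℝ, 4 * |t| ^ 3 * |x| ^ 3 ∂μ :=
        norm_integral_le_of_norm_le
          ((integrable_abs_cube_of_memLp_three h).const_mul _) (ae_of_all _ fun x => by
            have := norm_cexp_mul_I_sub_taylor_le (t * x)
            rwa [abs_mul, mul_pow, ← mul_assoc] at this)
    _ = _ := integral_const_mul _ _

/-- Telescoping: one factor is exchanged at a time, and the others have norm at most one. -/
theorem norm_prod_sub_prod_le_sum {ι : Type*} (s : Finset ι) (a b : ι → ℂ)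
    (ha : ∀ i ∈ s, ‖a i‖ ≤ 1) (hb : ∀ i ∈ s, ‖b i‖ ≤ 1) :
    ‖∏ i ∈ s, a i - ∏ i ∈ s, b i‖ ≤ ∑ i ∈ s, ‖a i - b i‖ := by
  classical
  induction s using Finset.induction_on with
  | empty => simp
  | insert j s hj ih =>
    rw [Finset.prod_insert hj, Finset.prod_insert hj, Finset.sum_insert hj]
    have ih' := ih (fun i hi => ha i (Finset.mem_insert_of_mem hi))
      (fun i hi => hb i (Finset.mem_insert_of_mem hi))
    have hbs : ‖∏ i ∈ s, a i‖ ≤ 1 := by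
      rw [norm_prod]
      exact Finset.prod_le_one (fun i _ => norm_nonneg _)
        fun i hi => ha i (Finset.mem_insert_of_mem hi)
    calc ‖a j * ∏ i ∈ s, a i - b j * ∏ i ∈ s, b i‖
        = ‖(a j - b j) * ∏ i ∈ s, a i + b j * (∏ i ∈ s, a i - ∏ i ∈ s, b i)‖ := by ring_nf
      _ ≤ ‖a j - b j‖ * ‖∏ i ∈ s, a i‖ + ‖b j‖ * ‖∏ i ∈ s, a i - ∏ i ∈ s, b i‖ := by
        refine (norm_add_le _ _).trans ?_
        rw [norm_mul, norm_mul]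
      _ ≤ ‖a j - b j‖ * 1 + 1 * ‖∏ i ∈ s, a i - ∏ i ∈ s, b i‖ := by
        gcongr
        exact hb j (Finset.mem_insert_self j s)
      _ ≤ _ := by rw [mul_one, one_mul]; gcongr

/-- Truncation at `δ`. After integration, small third moments make each mean, and likewise each
second moment, uniformly small. -/
theorem abs_le_add_cube_div {δ : ℝ} (hδ : 0 < δ) (x : ℝ) : |x| ≤ δ + |x| ^ 3 / δ ^ 2 := by
  have h0 := abs_nonneg x
  rcases le_total |x| δ with h | h
  · have : 0 ≤ |x| ^ 3 / δ ^ 2 := by positivity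
    linarith
  · have : |x| ≤ |x| ^ 3 / δ ^ 2 := by
      rw [le_div_iff₀ (by positivity)]
      calc |x| * δ ^ 2 ≤ |x| * |x| ^ 2 := by gcongr
        _ = |x| ^ 3 := by ring
    linarith

theorem sq_le_add_cube_div {δ : ℝ} (hδ : 0 < δ) (x : ℝ) : x ^ 2 ≤ δ ^ 2 + |x| ^ 3 / δ := by
  have h0 := abs_nonneg x
  rw [← sq_abs]
  rcases le_total |x| δ with h | h
  · have : 0 ≤ |x| ^ 3 / δ := by positivity
    have : |x| ^ 2 ≤ δ ^ 2 := by gcongr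
    linarith
  · have : |x| ^ 2 ≤ |x| ^ 3 / δ := by
      rw [le_div_iff₀ hδ]
      calc |x| ^ 2 * δ ≤ |x| ^ 2 * |x| := by gcongr
        _ = |x| ^ 3 := by ring
    nlinarith

theorem abs_integral_le_add_cube_div {μ : Measure ℝ} [IsProbabilityMeasure μ]
    (h : MemLp (fun x => x) 3 μ) {δ : ℝ} (hδ : 0 < δ) :
    |∫ x, x ∂μ| ≤ δ + (∫ x, |x| ^ 3 ∂μ) / δ ^ 2 := by
  have h3 := (integrable_abs_cube_of_memLp_three h).div_const (δ ^ 2)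
  calc |∫ x, x ∂μ| ≤ ∫ x, |x| ∂μ := abs_integral_le_integral_abs
    _ ≤ ∫ x, (δ + |x| ^ 3 / δ ^ 2) ∂μ :=
      integral_mono (integrable_id_of_memLp_three h).abs ((integrable_const _).add h3)
        (abs_le_add_cube_div hδ)
    _ = _ := by rw [integral_add (integrable_const _) h3, integral_div]; simp

theorem integral_sq_le_add_cube_div {μ : Measure ℝ} [IsProbabilityMeasure μ]
    (h : MemLp (fun x => x) 3 μ) {δ : ℝ} (hδ : 0 < δ) :
    ∫ x, x ^ 2 ∂μ ≤ δ ^ 2 + (∫ x, |x| ^ 3 ∂μ) / δ := by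
  have h3 := (integrable_abs_cube_of_memLp_three h).div_const δ
  calc ∫ x, x ^ 2 ∂μ ≤ ∫ x, (δ ^ 2 + |x| ^ 3 / δ) ∂μ :=
      integral_mono (integrable_sq_of_memLp_three h) ((integrable_const _).add h3)
        (sq_le_add_cube_div hδ)
    _ = _ := by rw [integral_add (integrable_const _) h3, integral_div]; simp

/-- Convergence of characteristic functions in the central limit theorem for triangular arrays,
under Lyapunov's condition of order three and with noncentred second moments. -/
theorem tendsto_prod_charFun (μ : (k : ℕ) → Fin k → Measure ℝ)
    [∀ k i, IsProbabilityMeasure (μ k i)]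
    (hLp : ∀ᶠ k in atTop, ∀ i, MemLp (fun x => x) 3 (μ k i)) {m v C : ℝ}
    (hm : Tendsto (fun k => ∑ i, ∫ x, x ∂μ k i) atTop (𝓝 m))
    (hm' : ∀ᶠ k in atTop, ∑ i, |∫ x, x ∂μ k i| ≤ C)
    (hv : Tendsto (fun k => ∑ i, ∫ x, x ^ 2 ∂μ k i) atTop (𝓝 v))
    (hc : Tendsto (fun k => ∑ i, ∫ x, |x| ^ 3 ∂μ k i) atTop (𝓝 0)) (t : ℝ) :
    Tendsto (fun k => ∏ i, charFun (μ k i) t) atTop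
      (𝓝 (Complex.exp (t * m * I - v * t ^ 2 / 2))) := by
  -- The second-order expansion of `charFun - 1`. The product is compared with `exp (∑ z)`, whose
  -- limit is immediate; `Re z ≤ 0` makes the factors `exp z` admissible for telescoping.
  set z : (k : ℕ) → Fin k → ℂ := fun k i =>
    ((t * ∫ x, x ∂μ k i : ℝ) : ℂ) * I - ((t ^ 2 * ∫ x, x ^ 2 ∂μ k i : ℝ) : ℂ) / 2 with hz
  have hb0 : ∀ k i, 0 ≤ ∫ x, x ^ 2 ∂μ k i := fun k i => integral_nonneg fun x => sq_nonneg x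
  have hc0 : ∀ k i, 0 ≤ ∫ x, |x| ^ 3 ∂μ k i := fun k i => integral_nonneg fun x => by positivity
  have hznorm : ∀ k i, ‖z k i‖ ≤ |t| * |∫ x, x ∂μ k i| + t ^ 2 * ∫ x, x ^ 2 ∂μ k i := by
    intro k i
    refine (norm_sub_le _ _).trans ?_
    rw [norm_mul, norm_div, Complex.norm_I, Complex.norm_real, Complex.norm_real, mul_one,
      Real.norm_eq_abs, Real.norm_eq_abs, abs_mul, abs_mul, abs_of_nonneg (hb0 k i),
      abs_of_nonneg (sq_nonneg t)]
    have : 0 ≤ t ^ 2 * ∫ x, x ^ 2 ∂μ k i := mul_nonneg (sq_nonneg t) (hb0 k i)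
    simp only [Complex.norm_ofNat]
    linarith
  have hexp : ∀ k i, ‖Complex.exp (z k i)‖ ≤ 1 := fun k i => by
    rw [Complex.norm_exp, Real.exp_le_one_iff]
    have : (z k i).re = -(t ^ 2 * ∫ x, x ^ 2 ∂μ k i) / 2 := by
      rw [hz]
      simp only [Complex.sub_re, Complex.re_ofReal_mul, Complex.I_re, Complex.div_ofNat_re,
        Complex.ofReal_re]
      ring
    rw [this]
    have : 0 ≤ t ^ 2 * ∫ x, x ^ 2 ∂μ k i := mul_nonneg (sq_nonneg t) (hb0 k i)
    linarith
  have hsum : Tendsto (fun k => Complex.exp (∑ i, z k i)) atTop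
      (𝓝 (Complex.exp (t * m * I - v * t ^ 2 / 2))) := by
    refine (Complex.continuous_exp.tendsto _).comp ?_
    have h1 := ((Complex.continuous_ofReal.tendsto _).comp (hm.const_mul t)).mul_const I
    have h2 := ((Complex.continuous_ofReal.tendsto _).comp (hv.const_mul (t ^ 2))).div_const 2
    convert h1.sub h2 using 2
    · simp only [hz, Function.comp_apply, Finset.sum_sub_distrib, Finset.mul_sum, Finset.sum_mul,
        Finset.sum_div, Complex.ofReal_sum]
    · push_cast; ring
  have hmax : ∀ ε > 0, ∀ᶠ k in atTop, ∀ i, ‖z k i‖ ≤ ε := by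
    intro ε hε
    obtain ⟨δ, hδ, hδε⟩ : ∃ δ > 0, |t| * δ + t ^ 2 * δ ^ 2 < ε / 2 := by
      have hcont : Tendsto (fun δ : ℝ => |t| * δ + t ^ 2 * δ ^ 2) (𝓝[>] 0) (𝓝 0) :=
        tendsto_nhdsWithin_of_tendsto_nhds
          (Continuous.tendsto' (by fun_prop) _ _ (by simp))
      exact ((eventually_mem_nhdsWithin).and
        (hcont.eventually_lt_const (half_pos hε))).exists
    have hCz : Tendsto (fun k => |t| * ((∑ i, ∫ x, |x| ^ 3 ∂μ k i) / δ ^ 2) +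
        t ^ 2 * ((∑ i, ∫ x, |x| ^ 3 ∂μ k i) / δ)) atTop (𝓝 0) := by
      simpa using ((hc.div_const (δ ^ 2)).const_mul |t|).add ((hc.div_const δ).const_mul (t ^ 2))
    filter_upwards [hLp, hCz.eventually_lt_const (half_pos hε)] with k hk hkε i
    have hci : ∫ x, |x| ^ 3 ∂μ k i ≤ ∑ i, ∫ x, |x| ^ 3 ∂μ k i :=
      Finset.single_le_sum (f := fun i => ∫ x, |x| ^ 3 ∂μ k i) (fun i _ => hc0 k i)
        (Finset.mem_univ i)
    calc ‖z k i‖ ≤ _ := hznorm k i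
      _ ≤ |t| * (δ + (∑ i, ∫ x, |x| ^ 3 ∂μ k i) / δ ^ 2) +
          t ^ 2 * (δ ^ 2 + (∑ i, ∫ x, |x| ^ 3 ∂μ k i) / δ) := by
        gcongr
        · exact (abs_integral_le_add_cube_div (hk i) hδ).trans (by gcongr)
        · exact (integral_sq_le_add_cube_div (hk i) hδ).trans (by gcongr)
      _ ≤ ε := by linarith
  obtain ⟨K, hK0, hK⟩ : ∃ K > 0, ∀ᶠ k in atTop, ∑ i, ‖z k i‖ ≤ K := by
    refine ⟨|t| * |C| + t ^ 2 * (|v| + 1) + 1, by positivity, ?_⟩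
    filter_upwards [hm', hv.eventually_lt_const (lt_add_one v)] with k hk1 hk2
    calc ∑ i, ‖z k i‖ ≤ ∑ i, (|t| * |∫ x, x ∂μ k i| + t ^ 2 * ∫ x, x ^ 2 ∂μ k i) :=
          Finset.sum_le_sum fun i _ => hznorm k i
      _ = |t| * ∑ i, |∫ x, x ∂μ k i| + t ^ 2 * ∑ i, ∫ x, x ^ 2 ∂μ k i := by
          rw [Finset.sum_add_distrib, Finset.mul_sum, Finset.mul_sum]
      _ ≤ |t| * |C| + t ^ 2 * (|v| + 1) := by
          gcongr
          · exact hk1.trans (le_abs_self C)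
          · exact hk2.le.trans (by gcongr; exact le_abs_self v)
      _ ≤ _ := by linarith
  have hdiff : Tendsto (fun k => ∏ i, charFun (μ k i) t - Complex.exp (∑ i, z k i)) atTop
      (𝓝 0) := by
    rw [Metric.tendsto_nhds]
    intro ε hε
    have hc' : Tendsto (fun k => 4 * |t| ^ 3 * ∑ i, ∫ x, |x| ^ 3 ∂μ k i) atTop (𝓝 0) := by
      simpa using hc.const_mul (4 * |t| ^ 3)
    -- The bound `1` validates `|exp z - 1 - z| ≤ |z|²`; the bound `ε / (2K)` then makes the sum of
    -- these errors at most `ε / 2`.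
    filter_upwards [hLp, hK, hmax (min 1 (ε / (2 * K))) (by positivity),
      hc'.eventually_lt_const (half_pos hε)] with k hk hkK hkmax hkc
    rw [dist_zero_right, Complex.exp_sum]
    calc _ ≤ ∑ i, ‖charFun (μ k i) t - Complex.exp (z k i)‖ :=
          norm_prod_sub_prod_le_sum _ _ _ (fun i _ => norm_charFun_le_one t) fun i _ => hexp k i
      _ ≤ ∑ i, (4 * |t| ^ 3 * ∫ x, |x| ^ 3 ∂μ k i + ε / (2 * K) * ‖z k i‖) := by
          refine Finset.sum_le_sum fun i _ => ?_
          have h1 := norm_charFun_sub_taylor_le (hk i) t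
          have h2 := Complex.norm_exp_sub_one_sub_id_le ((hkmax i).trans (min_le_left _ _))
          calc _ = ‖(charFun (μ k i) t - 1 - z k i) - (Complex.exp (z k i) - 1 - z k i)‖ := by
                congr 1; ring
            _ ≤ _ := norm_sub_le _ _
            _ ≤ _ := by
              refine add_le_add h1 (h2.trans ?_)
              rw [pow_two]
              gcongr
              exact (hkmax i).trans (min_le_right _ _)
      _ = 4 * |t| ^ 3 * ∑ i, ∫ x, |x| ^ 3 ∂μ k i + ε / (2 * K) * ∑ i, ‖z k i‖ := by
          rw [Finset.sum_add_distrib, Finset.mul_sum, Finset.mul_sum]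
      _ < ε / 2 + ε / (2 * K) * K :=
          add_lt_add_of_lt_of_le hkc (mul_le_mul_of_nonneg_left hkK (by positivity))
      _ = ε := by field_simp; ring
  simpa using hdiff.add hsum

end CentralLimit

/-! ### Log-likelihood ratios of product measures. -/

section Product

variable {ι : Type*} [Fintype ι] {Ω : ι → Type*} [∀ i, MeasurableSpace (Ω i)]
  {P Q : ∀ i, Measure (Ω i)} [∀ i, IsProbabilityMeasure (P i)] [∀ i, IsProbabilityMeasure (Q i)]
  {ℓ : ∀ i, Ω i → ℝ}

theorem map_pi_comp_eval (i : ι) {g : Ω i → ℝ} (hg : Measurable g) :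
    (Measure.pi P).map (fun ω => g (ω i)) = (P i).map g := by
  rw [← (measurePreserving_eval P i).map_eq, Measure.map_map hg (measurable_pi_apply i)]
  rfl

/-- A product measure is determined by its values on boxes, where the exponential of the sum
factorises and independence of the coordinates splits the integral. -/
theorem IsLogLikelihood.pi (h : ∀ i, IsLogLikelihood (P i) (Q i) (ℓ i)) :
    IsLogLikelihood (Measure.pi P) (Measure.pi Q) fun ω => ∑ i, ℓ i (ω i) := by
  refine ⟨Finset.measurable_sum _ fun i _ => (h i).1.comp (measurable_pi_apply i), ?_⟩
  refine Measure.pi_eq fun s hs => ?_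
  set g : ∀ i, Ω i → ℝ≥0∞ := fun i => (s i).indicator fun x => ENNReal.ofReal (Real.exp (ℓ i x))
  have hg : ∀ i, Measurable (g i) := fun i =>
    ((Real.measurable_exp.comp (h i).1).ennreal_ofReal).indicator (hs i)
  have hind : iIndepFun (fun i (ω : ∀ i, Ω i) => g i (ω i)) (Measure.pi P) :=
    iIndepFun_pi fun i => (hg i).aemeasurable
  have hbox : MeasurableSet (univ.pi s) := MeasurableSet.univ_pi hs
  rw [withDensity_apply _ hbox, ← lintegral_indicator hbox]
  calc _ = ∫⁻ ω, ∏ i, g i (ω i) ∂Measure.pi P := by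
        refine lintegral_congr fun ω => ?_
        by_cases hω : ω ∈ univ.pi s
        · rw [indicator_of_mem hω, Real.exp_sum,
            ENNReal.ofReal_prod_of_nonneg fun i _ => (Real.exp_pos _).le]
          exact Finset.prod_congr rfl fun i _ => by
            simp only [g, indicator_of_mem (hω i (mem_univ i))]
        · rw [indicator_of_notMem hω]
          simp only [mem_univ_pi, not_forall] at hω
          obtain ⟨i, hi⟩ := hω
          exact (Finset.prod_eq_zero (Finset.mem_univ i) (indicator_of_notMem hi _)).symm
    _ = ∏ i, ∫⁻ ω, g i (ω i) ∂Measure.pi P :=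
        lintegral_prod_eq_prod_lintegral_of_indepFun _ _ hind
          fun i => (hg i).comp (measurable_pi_apply i)
    _ = ∏ i, Q i (s i) := by
        refine Finset.prod_congr rfl fun i _ => ?_
        rw [(measurePreserving_eval P i).lintegral_comp (hg i), lintegral_indicator (hs i),
          ← withDensity_apply _ (hs i), ← (h i).2]

theorem charFun_map_pi_sum (hℓ : ∀ i, Measurable (ℓ i)) (t : ℝ) :
    charFun ((Measure.pi P).map fun ω => ∑ i, ℓ i (ω i)) t =
      ∏ i, charFun ((P i).map (ℓ i)) t := by
  have hind : iIndepFun (fun i (ω : ∀ i, Ω i) => ℓ i (ω i)) (Measure.pi P) :=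
    iIndepFun_pi fun i => (hℓ i).aemeasurable
  have hm : ∀ i, AEMeasurable (fun ω : ∀ i, Ω i => ℓ i (ω i)) (Measure.pi P) :=
    fun i => ((hℓ i).comp (measurable_pi_apply i)).aemeasurable
  rw [hind.charFun_map_fun_sum_eq_prod hm, Finset.prod_apply]
  exact Finset.prod_congr rfl fun i _ => by rw [map_pi_comp_eval i (hℓ i)]

end Product

theorem charFun_map_neg_real (μ : Measure ℝ) (t : ℝ) :
    charFun (μ.map fun x => -x) t = charFun μ (-t) := by
  have h := charFun_map_mul (μ := μ) (-1) t
  simpa using h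

/-- The log-likelihood ratio of a composition of symmetric trade-off functions: its laws `μ` under
the null and `ν` under the alternative, and the bounds they give through the Neyman-Pearson
lemma. -/
theorem IsComposition.exists_laws {k : ℕ} {f : Fin k → ℝ → ℝ} {h : ℝ → ℝ}
    (hc : IsComposition.{u} f h) (hsymm : ∀ i, EqOn (f i) (tradeoffInv (f i)) (Icc 0 1))
    (h3 : ∀ i, nu3 (f i) ≠ ⊤) :
    (∀ i, ∫ x, x ∂logDerivLaw (f i) ≤ 0) ∧
    ∃ μ ν : ProbabilityMeasure ℝ,
      (∀ t, charFun (μ : Measure ℝ) t = ∏ i, charFun (logDerivLaw (f i)) t) ∧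
      (∀ t, charFun (ν : Measure ℝ) t = ∏ i, charFun (logDerivLaw (f i)) (-t)) ∧
      AntitoneOn h (Icc 0 1) ∧ h 0 = 1 ∧ h 1 = 0 ∧
      ∀ c, ∀ α ∈ Icc (0 : ℝ) 1,
        1 - Real.exp c * α - ((ν : Measure ℝ).real (Ioi c) -
          Real.exp c * (μ : Measure ℝ).real (Ioi c)) ≤ h α ∧
        ((μ : Measure ℝ).real (Ioi c) ≤ α → h α ≤ 1 - (ν : Measure ℝ).real (Ioi c)) := by
  obtain ⟨Ω, _, P, Q, hP, hQ, hf, hh⟩ := hc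
  refine ⟨fun i => integral_logDerivLaw_nonpos (hf i) (hsymm i) (h3 i), ?_⟩
  have hℓ : ∀ i, IsLogLikelihood (P i) (Q i) (llr (Q i) (P i)) := fun i =>
    isLogLikelihood_of_symmetric (hf i) (hsymm i) (h3 i)
  have hL := IsLogLikelihood.pi hℓ
  set L : (∀ i, Ω i) → ℝ := fun ω => ∑ i, llr (Q i) (P i) (ω i)
  have hQP : Measure.pi Q ≪ Measure.pi P := by
    rw [hL.2]
    exact withDensity_absolutelyContinuous _ _
  have hreal : ∀ (R : Measure (∀ i, Ω i)) (c : ℝ), (R.map L).real (Ioi c) = R.real {ω | c < L ω} :=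
    fun R c => by rw [map_measureReal_apply hL.1 measurableSet_Ioi]; rfl
  refine ⟨⟨(Measure.pi P).map L, Measure.isProbabilityMeasure_map hL.1.aemeasurable⟩,
    ⟨(Measure.pi Q).map L, Measure.isProbabilityMeasure_map hL.1.aemeasurable⟩, fun t => ?_,
    fun t => ?_, ?_, ?_, ?_, fun c α hα => ?_⟩
  · refine (charFun_map_pi_sum (fun i => measurable_llr (Q i) (P i)) t).trans ?_
    exact Finset.prod_congr rfl fun i _ => by
      rw [map_llr_left_of_symmetric (hf i) (hsymm i) (h3 i)]
  · refine (charFun_map_pi_sum (fun i => measurable_llr (Q i) (P i)) t).trans ?_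
    exact Finset.prod_congr rfl fun i _ => by
      rw [map_llr_right_of_symmetric (hf i) (hsymm i) (h3 i), charFun_map_neg_real]
  · exact (tradeoff_antitoneOn.mono Icc_subset_Ici_self).congr hh.symm
  · rw [hh (by simp), tradeoff_zero hQP]
  · rw [hh (by simp), tradeoff_one]
  · simp only [ProbabilityMeasure.coe_mk, hreal]
    rw [hh hα]
    exact ⟨hL.le_tradeoff c hα.1, tradeoff_le_of_measurableSet (hL.measurableSet_lt c)⟩

/-! ### Tail functions of probability measures on the line. -/

section Survival

variable {μ : Measure ℝ} [IsProbabilityMeasure μ]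

theorem measureReal_Ioi_eq_one_sub_cdf (c : ℝ) : μ.real (Ioi c) = 1 - cdf μ c := by
  rw [← compl_Iic, probReal_compl_eq_one_sub measurableSet_Iic, cdf_eq_real]

theorem tendsto_measureReal_Ioi_atTop : Tendsto (fun c => μ.real (Ioi c)) atTop (𝓝 0) := by
  simp_rw [measureReal_Ioi_eq_one_sub_cdf]
  simpa using (tendsto_cdf_atTop μ).const_sub 1

theorem tendsto_measureReal_Ioi_atBot : Tendsto (fun c => μ.real (Ioi c)) atBot (𝓝 1) := by
  simp_rw [measureReal_Ioi_eq_one_sub_cdf]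
  simpa using (tendsto_cdf_atBot μ).const_sub 1

theorem continuous_measureReal_Ioi (h : ∀ x, μ {x} = 0) :
    Continuous fun c => μ.real (Ioi c) := by
  simp_rw [measureReal_Ioi_eq_one_sub_cdf]
  refine continuous_const.sub (continuous_iff_continuousAt.2 fun c => ?_)
  rw [(monotone_cdf μ).continuousAt_iff_leftLim_eq_rightLim, StieltjesFunction.rightLim_eq]
  have h1 := (cdf μ).measure_singleton c
  rw [measure_cdf, h c, eq_comm, ENNReal.ofReal_eq_zero] at h1
  exact le_antisymm ((monotone_cdf μ).leftLim_le le_rfl) (by linarith)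

end Survival

/-! ### Gaussian trade-off functions. -/

section Gaussian

theorem gaussianReal_singleton (m : ℝ) {v : NNReal} (hv : v ≠ 0) (x : ℝ) :
    gaussianReal m v {x} = 0 :=
  gaussianReal_absolutelyContinuous m hv (by simp)

theorem strictAnti_gaussianReal_Ioi (m : ℝ) {v : NNReal} (hv : v ≠ 0) :
    StrictAnti fun c => (gaussianReal m v).real (Ioi c) := by
  intro a b hab
  have hpos : 0 < (gaussianReal m v).real (Ioc a b) := by
    refine measureReal_nonneg.lt_of_ne' fun h0 => ?_
    rw [measureReal_eq_zero_iff] at h0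
    have := gaussianReal_absolutelyContinuous' m hv h0
    rw [Real.volume_Ioc, ENNReal.ofReal_eq_zero] at this
    linarith
  have hU : Ioc a b ∪ Ioi b = Ioi a := Ioc_union_Ioi_eq_Ioi hab.le
  simp only
  have hdisj : Disjoint (Ioc a b) (Ioi b) := Set.disjoint_left.2 fun x hx hx' => not_lt.2 hx.2 hx'
  rw [← hU, measureReal_union hdisj measurableSet_Ioi]
  linarith

theorem isLogLikelihood_gaussianReal (m : ℝ) :
    IsLogLikelihood (gaussianReal 0 1) (gaussianReal m 1) fun x => m * x - m ^ 2 / 2 := by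
  refine ⟨by fun_prop, ?_⟩
  rw [gaussianReal_of_var_ne_zero _ one_ne_zero, gaussianReal_of_var_ne_zero _ one_ne_zero,
    ← withDensity_mul _ (measurable_gaussianPDF _ _) (by fun_prop)]
  congr 1
  ext x
  simp only [gaussianPDF, Pi.mul_apply]
  rw [← ENNReal.ofReal_mul (gaussianPDFReal_nonneg _ _ _)]
  congr 1
  simp only [gaussianPDFReal, mul_assoc, ← Real.exp_add]
  congr 3
  simp
  ring

/-- For `m > 0` the likelihood ratio is increasing, so half-lines are the Neyman-Pearson tests. For
`m = 0` it is constant and the claim is checked directly. -/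
theorem gaussianTradeoff_apply {m : ℝ} (hm : 0 ≤ m) (c : ℝ) :
    gaussianTradeoff m ((gaussianReal 0 1).real (Ioi c)) = 1 - (gaussianReal m 1).real (Ioi c) := by
  rcases hm.eq_or_lt with rfl | hm
  · refine le_antisymm (tradeoff_le_one_sub ⟨measureReal_nonneg, measureReal_le_one⟩)
      (le_tradeoff measureReal_nonneg fun φ _ _ hφ => by linarith)
  · have h := (isLogLikelihood_gaussianReal m).tradeoff_eq (m * c - m ^ 2 / 2)
    have hset : {x : ℝ | m * c - m ^ 2 / 2 < m * x - m ^ 2 / 2} = Ioi c := by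
      ext x
      simp [mul_lt_mul_iff_right₀ hm]
    rwa [hset] at h

theorem gaussianTradeoff_zero (m : ℝ) : gaussianTradeoff m 0 = 1 :=
  tradeoff_zero ((gaussianReal_absolutelyContinuous m one_ne_zero).trans
    (gaussianReal_absolutelyContinuous' 0 one_ne_zero))

theorem gaussianTradeoff_one (m : ℝ) : gaussianTradeoff m 1 = 0 := tradeoff_one

theorem gaussianReal_Ioi_affine (m d : ℝ) {s : ℝ} (hs : 0 < s) (c : ℝ) :
    (gaussianReal (s * m + d) (NNReal.mk (s ^ 2) (sq_nonneg s))).real (Ioi (s * c + d)) =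
      (gaussianReal m 1).real (Ioi c) := by
  have h1 : gaussianReal (s * m + d) (NNReal.mk (s ^ 2) (sq_nonneg s)) =
      (gaussianReal m 1).map (fun x => s * x + d) := by
    have := gaussianReal_map_add_const (μ := s * m) (v := NNReal.mk (s ^ 2) (sq_nonneg s)) d
    rw [← this]
    have h2 := gaussianReal_map_const_mul (μ := m) (v := 1) s
    rw [mul_one] at h2
    rw [← h2, Measure.map_map (by fun_prop) (by fun_prop)]
    rfl
  rw [h1, map_measureReal_apply (by fun_prop) measurableSet_Ioi]
  congr 1
  ext x
  simp [mul_lt_mul_iff_right₀ hs]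

theorem exists_gaussianReal_Ioi_eq {x : ℝ} (hx : x ∈ Ioo (0 : ℝ) 1) :
    ∃ c, (gaussianReal 0 1).real (Ioi c) = x := by
  have h := mem_range_of_exists_le_of_exists_ge
    (continuous_measureReal_Ioi (gaussianReal_singleton 0 one_ne_zero))
    (((tendsto_measureReal_Ioi_atTop (μ := gaussianReal 0 1)).eventually_le_const hx.1).exists)
    (((tendsto_measureReal_Ioi_atBot (μ := gaussianReal 0 1)).eventually_const_le hx.2).exists)
  exact h

theorem continuousOn_gaussianTradeoff {m : ℝ} (hm : 0 ≤ m) :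
    ContinuousOn (gaussianTradeoff m) (Icc 0 1) := by
  have hanti : AntitoneOn (gaussianTradeoff m) (Ici 0) := tradeoff_antitoneOn
  intro x hx
  rcases hx.1.eq_or_lt with rfl | hx0
  · rw [ContinuousWithinAt, gaussianTradeoff_zero, tendsto_order]
    constructor
    · intro l hl
      -- A far half-line has positive level but type-II error above `l`; monotonicity extends this
      -- to all smaller levels.
      obtain ⟨c, hc⟩ := ((tendsto_measureReal_Ioi_atTop (μ := gaussianReal m 1)).eventually_lt_const
        (sub_pos.2 hl)).exists
      have hpos : 0 < (gaussianReal 0 1).real (Ioi c) :=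
        measureReal_nonneg.trans_lt (strictAnti_gaussianReal_Ioi 0 one_ne_zero (lt_add_one c))
      filter_upwards [mem_nhdsWithin_of_mem_nhds (Iio_mem_nhds hpos), self_mem_nhdsWithin]
        with y hy hyI
      calc l < 1 - (gaussianReal m 1).real (Ioi c) := by linarith
        _ = gaussianTradeoff m _ := (gaussianTradeoff_apply hm c).symm
        _ ≤ gaussianTradeoff m y := hanti hyI.1 hpos.le (le_of_lt hy)
    · intro u hu
      filter_upwards [self_mem_nhdsWithin] with y hy
      exact lt_of_le_of_lt ((tradeoff_le_one_sub hy).trans (by linarith [hy.1])) hu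
  rcases hx.2.eq_or_lt with rfl | hx1
  · rw [ContinuousWithinAt, gaussianTradeoff_one]
    have hlim : Tendsto (fun y : ℝ => 1 - y) (𝓝[Icc 0 1] 1) (𝓝 0) :=
      tendsto_nhdsWithin_of_tendsto_nhds (Continuous.tendsto' (by fun_prop) _ _ (by simp))
    refine tendsto_of_tendsto_of_tendsto_of_le_of_le' tendsto_const_nhds hlim ?_ ?_
    · filter_upwards [self_mem_nhdsWithin] with y hy using tradeoff_nonneg hy.1
    · filter_upwards [self_mem_nhdsWithin] with y hy using tradeoff_le_one_sub hy
  · have hc : ConvexOn ℝ (Icc 0 1) (gaussianTradeoff m) := tradeoff_convexOn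
    have := hc.continuousOn_interior
    rw [interior_Icc] at this
    exact (this.continuousAt (Ioo_mem_nhds hx0 hx1)).continuousWithinAt

end Gaussian

/-! ### Passage to the limit. -/

/-- Pólya's theorem: pointwise convergence of antitone functions on a compact interval to a
continuous function is uniform. -/
theorem tendstoUniformlyOn_Icc_of_antitoneOn {ι : Type*} {l : Filter ι} {F : ι → ℝ → ℝ}
    {G : ℝ → ℝ} {a b : ℝ} (hF : ∀ᶠ k in l, AntitoneOn (F k) (Icc a b))
    (hG : ContinuousOn G (Icc a b)) (hlim : ∀ x ∈ Icc a b, Tendsto (F · x) l (𝓝 (G x))) :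
    TendstoUniformlyOn F G l (Icc a b) := by
  rw [← tendstoLocallyUniformlyOn_iff_tendstoUniformlyOn_of_compact isCompact_Icc,
    Metric.tendstoLocallyUniformlyOn_iff]
  intro ε hε x hx
  obtain ⟨δ, hδ, hδG⟩ := Metric.continuousOn_iff.1 hG x hx (ε / 4) (by positivity)
  -- Near `x`, monotonicity traps `F k` between its values at `p` and `q`, clipped to the interval.
  set p := max a (x - δ / 2)
  set q := min b (x + δ / 2)
  have hp : p ∈ Icc a b := ⟨le_max_left _ _, max_le (hx.1.trans hx.2) (by linarith [hx.2])⟩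
  have hq : q ∈ Icc a b := ⟨le_min (hx.1.trans hx.2) (by linarith [hx.1]), min_le_left _ _⟩
  have hpd : dist p x < δ := by
    have h1 : x - δ / 2 ≤ p := le_max_right _ _
    have h2 : p ≤ x := max_le hx.1 (by linarith)
    rw [Real.dist_eq, abs_lt]
    constructor <;> linarith
  have hqd : dist q x < δ := by
    have h1 : q ≤ x + δ / 2 := min_le_right _ _
    have h2 : x ≤ q := le_min hx.2 (by linarith)
    rw [Real.dist_eq, abs_lt]
    constructor <;> linarith
  refine ⟨Icc a b ∩ Metric.ball x (δ / 2), inter_mem_nhdsWithin _ (Metric.ball_mem_nhds x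
    (by positivity)), ?_⟩
  filter_upwards [hF, Metric.tendsto_nhds.1 (hlim p hp) (ε / 4) (by positivity),
    Metric.tendsto_nhds.1 (hlim q hq) (ε / 4) (by positivity)] with k hk hkp hkq y hy
  have hyd : dist y x < δ / 2 := hy.2
  have hGp := hδG p hp hpd
  have hGq := hδG q hq hqd
  have hGy := hδG y hy.1 (by linarith)
  rw [Real.dist_eq, abs_lt] at hyd hGp hGq hGy hkp hkq ⊢
  have h1 : F k y ≤ F k p := hk hp hy.1 (max_le hy.1.1 (by linarith))
  have h2 : F k q ≤ F k y := hk hy.1 hq (le_min hy.1.2 (by linarith))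
  constructor <;> linarith

/-- Lévy's continuity theorem; the boundary point of a half-line is null for the Gaussian limit. -/
theorem tendsto_measureReal_Ioi_of_tendsto_charFun {μ : ℕ → ProbabilityMeasure ℝ} {m : ℝ}
    {v : NNReal} (hv : v ≠ 0)
    (h : ∀ t : ℝ, Tendsto (fun k => charFun (μ k : Measure ℝ) t) atTop
      (𝓝 (Complex.exp (t * m * Complex.I - v * t ^ 2 / 2)))) (c : ℝ) :
    Tendsto (fun k => (μ k : Measure ℝ).real (Ioi c)) atTop
      (𝓝 ((gaussianReal m v).real (Ioi c))) := by
  have hlim : Tendsto μ atTop (𝓝 (⟨gaussianReal m v, inferInstance⟩ : ProbabilityMeasure ℝ)) :=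
    ProbabilityMeasure.tendsto_of_tendsto_charFun fun t => by
      simpa [charFun_gaussianReal] using h t
  have := ProbabilityMeasure.tendsto_measure_of_null_frontier_of_tendsto' hlim (E := Ioi c)
    (by simpa using gaussianReal_singleton m hv c)
  exact (ENNReal.tendsto_toReal (measure_ne_top _ _)).comp this

/-- Functions trapped by the Neyman-Pearson bounds of log-likelihood ratios that are
asymptotically `N(-M, s²)` under the null and `N(M, s²)` under the alternative converge to
`G_{2M/s}`. -/
theorem tendsto_gaussianTradeoff {F : ℕ → ℝ → ℝ} {a b : ℕ → ℝ → ℝ} {M s : ℝ} (hM : 0 ≤ M)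
    (hs : 0 < s)
    (ha : ∀ c, Tendsto (fun k => a k (s * c - M)) atTop (𝓝 ((gaussianReal 0 1).real (Ioi c))))
    (hb : ∀ c, Tendsto (fun k => b k (s * c - M)) atTop
      (𝓝 ((gaussianReal (2 * M / s) 1).real (Ioi c))))
    (hF : ∀ᶠ k in atTop, ∀ c, ∀ α ∈ Icc (0 : ℝ) 1,
      1 - Real.exp c * α - (b k c - Real.exp c * a k c) ≤ F k α ∧ (a k c ≤ α → F k α ≤ 1 - b k c))
    {x : ℝ} (hx : x ∈ Ioo (0 : ℝ) 1) :
    Tendsto (F · x) atTop (𝓝 (gaussianTradeoff (2 * M / s) x)) := by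
  have hxI := Ioo_subset_Icc_self hx
  obtain ⟨c, rfl⟩ := exists_gaussianReal_Ioi_eq hx
  rw [gaussianTradeoff_apply (by positivity), tendsto_order]
  constructor
  · intro l hl
    -- In the limit the two exponential terms cancel, leaving the Gaussian type-II error, so no
    -- relation between `M` and `s` is needed.
    have hlow := ((hb c).sub ((ha c).const_mul (Real.exp (s * c - M)))).const_sub
      (1 - Real.exp (s * c - M) * (gaussianReal 0 1).real (Ioi c))
    have := hlow.eventually_const_lt (u := l) (by linarith)
    filter_upwards [hF, this] with k hk hkl
    exact hkl.trans_le (hk _ _ hxI).1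
  · intro u hu
    have hcont := (continuous_measureReal_Ioi
      (gaussianReal_singleton (2 * M / s) one_ne_zero)).tendsto c
    -- The test at `c` may slightly exceed the level for finite `k`. A threshold `d > c` has
    -- strictly smaller limiting level, and by continuity little power is lost.
    obtain ⟨d, hdu, hcd⟩ := (((tendsto_nhdsWithin_of_tendsto_nhds (s := Ioi c)
      hcont).const_sub 1).eventually_lt_const hu |>.and self_mem_nhdsWithin).exists
    filter_upwards [hF, (ha d).eventually_le_const
      (strictAnti_gaussianReal_Ioi 0 one_ne_zero hcd),
      ((hb d).const_sub 1).eventually_lt_const hdu] with k hk hka hkb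
    exact ((hk _ _ hxI).2 hka).trans_lt hkb

theorem ereal_coe_sum {ι : Type*} (t : Finset ι) (g : ι → ℝ) :
    ((∑ i ∈ t, g i : ℝ) : EReal) = ∑ i ∈ t, (g i : EReal) :=
  map_sum (⟨⟨Real.toEReal, EReal.coe_zero⟩, EReal.coe_add⟩ : ℝ →+ EReal) g t

theorem mainTheorem1
    (f : (k : ℕ) → Fin k → ℝ → ℝ)
    (hf : ∀ (k : ℕ) (i : Fin k), IsSymmetricTradeoff.{u} (f k i))
    (F : ℕ → ℝ → ℝ)
    (hF : ∀ k : ℕ, 1 ≤ k → IsComposition.{u} (f k) (F k))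
    (M s : ℝ) (hM : 0 ≤ M) (hs : 0 < s)
    (h1 : Tendsto (fun k : ℕ => ∑ i, nu1 (f k i)) atTop (𝓝 (M : EReal)))
    (h1max : Tendsto (fun k : ℕ => ⨆ i, nu1 (f k i)) atTop (𝓝 (0 : EReal)))
    (h2 : Tendsto (fun k : ℕ => ∑ i, nu2 (f k i)) atTop (𝓝 (ENNReal.ofReal (s ^ 2))))
    (h3 : Tendsto (fun k : ℕ => ∑ i, nu3 (f k i)) atTop (𝓝 (0 : ℝ≥0∞))) :
    TendstoUniformlyOn F (gaussianTradeoff (2 * M / s)) atTop (Icc (0 : ℝ) 1) := by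
  have hfin : ∀ᶠ k in atTop, 1 ≤ k ∧ ∀ i, nu3 (f k i) ≠ ⊤ := by
    filter_upwards [h3.eventually_lt_const ENNReal.zero_lt_top, eventually_ge_atTop 1]
      with k hk hk1
    exact ⟨hk1, fun i => (ENNReal.sum_lt_top.1 hk i (Finset.mem_univ i)).ne⟩
  have hlaws := fun (k : ℕ) (hk : 1 ≤ k ∧ ∀ i, nu3 (f k i) ≠ ⊤) =>
    (hF k hk.1).exists_laws (fun i => (hf k i).2) hk.2
  have hneg : ∀ᶠ k in atTop, ∀ i, ∫ x, x ∂logDerivLaw (f k i) ≤ 0 :=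
    hfin.mono fun k hk => (hlaws k hk).1
  have hex : ∀ k, ∃ μν : ProbabilityMeasure ℝ × ProbabilityMeasure ℝ,
      (1 ≤ k ∧ ∀ i, nu3 (f k i) ≠ ⊤) →
      (∀ t, charFun (μν.1 : Measure ℝ) t = ∏ i, charFun (logDerivLaw (f k i)) t) ∧
      (∀ t, charFun (μν.2 : Measure ℝ) t = ∏ i, charFun (logDerivLaw (f k i)) (-t)) ∧
      AntitoneOn (F k) (Icc 0 1) ∧ F k 0 = 1 ∧ F k 1 = 0 ∧
      ∀ c, ∀ α ∈ Icc (0 : ℝ) 1,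
        1 - Real.exp c * α - ((μν.2 : Measure ℝ).real (Ioi c) -
          Real.exp c * (μν.1 : Measure ℝ).real (Ioi c)) ≤ F k α ∧
        ((μν.1 : Measure ℝ).real (Ioi c) ≤ α → F k α ≤ 1 - (μν.2 : Measure ℝ).real (Ioi c)) := by
    intro k
    by_cases hk : 1 ≤ k ∧ ∀ i, nu3 (f k i) ≠ ⊤
    · obtain ⟨-, μ, ν, h⟩ := hlaws k hk
      exact ⟨(μ, ν), fun _ => h⟩
    -- An arbitrary value for the `k` without the finiteness; only large `k` matter.
    · exact ⟨(⟨unitVolume, inferInstance⟩, ⟨unitVolume, inferInstance⟩), fun h => absurd h hk⟩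
  choose μν hμν using hex
  have hm : Tendsto (fun k => ∑ i, ∫ x, x ∂logDerivLaw (f k i)) atTop (𝓝 (-M)) := by
    have : Tendsto (fun k => -∑ i, ∫ x, x ∂logDerivLaw (f k i)) atTop (𝓝 M) := by
      refine EReal.tendsto_coe.1 (h1.congr' ?_)
      filter_upwards [hfin] with k hk
      rw [← Finset.sum_neg_distrib, ereal_coe_sum]
      exact Finset.sum_congr rfl fun i _ => nu1_eq_coe (hk.2 i)
    simpa using this.neg
  have hm' : ∀ᶠ k in atTop, ∑ i, |∫ x, x ∂logDerivLaw (f k i)| ≤ M + 1 := by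
    filter_upwards [hneg, hm.eventually_const_lt (sub_one_lt (-M))] with k hk hkm
    rw [Finset.sum_congr rfl fun i _ => abs_of_nonpos (hk i), Finset.sum_neg_distrib]
    linarith
  have hv : Tendsto (fun k => ∑ i, ∫ x, x ^ 2 ∂logDerivLaw (f k i)) atTop (𝓝 (s ^ 2)) := by
    have := (ENNReal.tendsto_toReal ENNReal.ofReal_ne_top).comp h2
    rw [ENNReal.toReal_ofReal (sq_nonneg s)] at this
    refine this.congr' ?_
    filter_upwards [hfin] with k hk
    have hnn : ∀ i, 0 ≤ ∫ x, x ^ 2 ∂logDerivLaw (f k i) := fun i =>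
      integral_nonneg fun x => sq_nonneg x
    simp only [Function.comp_apply]
    rw [Finset.sum_congr rfl fun i _ => nu2_eq_ofReal (hk.2 i),
      ← ENNReal.ofReal_sum_of_nonneg fun i _ => hnn i,
      ENNReal.toReal_ofReal (Finset.sum_nonneg fun i _ => hnn i)]
  have hc : Tendsto (fun k => ∑ i, ∫ x, |x| ^ 3 ∂logDerivLaw (f k i)) atTop (𝓝 0) := by
    have := (ENNReal.tendsto_toReal ENNReal.zero_ne_top).comp h3
    rw [ENNReal.toReal_zero] at this
    refine this.congr' ?_
    filter_upwards [hfin] with k hk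
    have hnn : ∀ i, 0 ≤ ∫ x, |x| ^ 3 ∂logDerivLaw (f k i) := fun i =>
      integral_nonneg fun x => by positivity
    simp only [Function.comp_apply]
    rw [Finset.sum_congr rfl fun i _ => nu3_eq_ofReal (hk.2 i),
      ← ENNReal.ofReal_sum_of_nonneg fun i _ => hnn i,
      ENNReal.toReal_ofReal (Finset.sum_nonneg fun i _ => hnn i)]
  have hchar := tendsto_prod_charFun (fun k i => logDerivLaw (f k i))
    (hfin.mono fun k hk i => memLp_logDerivLaw (hk.2 i)) hm hm' hv hc
  set v : NNReal := NNReal.mk (s ^ 2) (sq_nonneg s) with hvdef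
  have hv0 : v ≠ 0 := by
    rw [← NNReal.coe_ne_zero]
    exact (pow_pos hs 2).ne'
  have hvs : (v : ℝ) = s ^ 2 := rfl
  have ha : ∀ c, Tendsto (fun k => ((μν k).1 : Measure ℝ).real (Ioi (s * c - M))) atTop
      (𝓝 ((gaussianReal 0 1).real (Ioi c))) := fun c => by
    have h := gaussianReal_Ioi_affine 0 (-M) hs c
    rw [mul_zero, zero_add] at h
    rw [← h]
    refine tendsto_measureReal_Ioi_of_tendsto_charFun hv0 (fun t => ?_) _
    refine Tendsto.congr' ?_ (hchar t)
    filter_upwards [hfin] with k hk using ((hμν k hk).1 t).symm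
  have hb : ∀ c, Tendsto (fun k => ((μν k).2 : Measure ℝ).real (Ioi (s * c - M))) atTop
      (𝓝 ((gaussianReal (2 * M / s) 1).real (Ioi c))) := fun c => by
    have h := gaussianReal_Ioi_affine (2 * M / s) (-M) hs c
    rw [mul_div_cancel₀ _ hs.ne', show 2 * M + -M = M by ring] at h
    rw [← h]
    refine tendsto_measureReal_Ioi_of_tendsto_charFun hv0 (fun t => ?_) _
    -- Reflecting the laws turns the limit mean `-M` into `M` and keeps the variance.
    have ht := hchar (-t)
    rw [show ((-t : ℝ) : ℂ) * ((-M : ℝ) : ℂ) * Complex.I - ((s ^ 2 : ℝ) : ℂ) * ((-t : ℝ) : ℂ) ^ 2 / 2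
      = t * M * Complex.I - ((s ^ 2 : ℝ) : ℂ) * t ^ 2 / 2 by push_cast; ring] at ht
    refine Tendsto.congr' ?_ ht
    filter_upwards [hfin] with k hk using ((hμν k hk).2.1 t).symm
  refine tendstoUniformlyOn_Icc_of_antitoneOn (hfin.mono fun k hk => (hμν k hk).2.2.1)
    (continuousOn_gaussianTradeoff (by positivity)) fun x hx => ?_
  -- The endpoints are not Gaussian tail probabilities, but there all functions involved agree
  -- exactly for large `k`.
  rcases hx.1.eq_or_lt with rfl | hx0
  · rw [gaussianTradeoff_zero]
    exact tendsto_const_nhds.congr' (hfin.mono fun k hk => (hμν k hk).2.2.2.1.symm)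
  rcases hx.2.eq_or_lt with rfl | hx1
  · rw [gaussianTradeoff_one]
    exact tendsto_const_nhds.congr' (hfin.mono fun k hk => (hμν k hk).2.2.2.2.1.symm)
  · exact tendsto_gaussianTradeoff hM hs
      (a := fun k c => ((μν k).1 : Measure ℝ).real (Ioi c))
      (b := fun k c => ((μν k).2 : Measure ℝ).real (Ioi c)) ha hb
      (hfin.mono fun k hk => (hμν k hk).2.2.2.2.2) ⟨hx0, hx1⟩
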